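/- Let $A$ be a symmetrizable generalized Cartan matrix, let $(\mathfrak h,\{\alpha_i\},\{\alpha_i^\vee\})$ be a realization of $A$ over $\mathbb C$, and let $\mathfrak g$ be the associated Kac--Moody algebra (generated by $\mathfrak h$, $e_i$, $f_i$ with the Chevalley--Serre relations), with roots $\Delta=\Delta^+\sqcup\Delta^-$. Let $P\subseteq\mathfrak h^*$ be a restricted weight lattice. A $\mathfrak g$-module $V$ with action $\rho$ is called standard graded, with grading function $f$, if $V$ is the direct sum of its weight spaces $V_\mu$, these are finite dimensional, all weights of $V$ lie in $P$, and $f:P\to\mathbb Z$ is an additive map such that, writing $\Delta_m=\{\alpha\in\Delta\cup\{0\}: f(\alpha)=m\}$ and $\mathrm{wts}_m(V)=\{\mu \text{ a weight of } V: f(\mu)=m\}$: both sets are finite for all $m$; $\Delta_m\subseteq\Delta^+$ for $m>0$, $\Delta_0=\{0\}$, $\Delta_m\subseteq\Delta^-$ for $m<0$; and the elements of $\mathrm{wts}_m(V)$ are pairwise incomparable in the dominance order. Put $\mathfrak g_m=\bigoplus_{\alpha\in\Delta_m}\mathfrak g_\alpha$, $V_m=\bigoplus_{\mu\in \mathrm{wts}_m(V)}V_\mu$,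 $$\widehat{\mathfrak g}=\bigoplus_{m<0}\mathfrak g_m\oplus\prod_{m\ge0}\mathfrak g_m,\quad \widehat V=\bigoplus_{m<0}V_m\oplus\prod_{m\ge0}V_m,\quad \widehat{\mathfrak n}^+=\prod_{m\ge1}\mathfrak g_m,\quad \widehat N_k=\prod_{m\ge k}V_m ,$$ where $\widehat N_k$ consists of the elements of $\widehat V$ supported in degrees $\ge k$. Let $\pi_k:\widehat V\to V_k$ be the projections and write $v_k=\pi_k(v)$. The Lie algebra $\widehat{\mathfrak g}$ acts on $\widehat V$ by the natural extension of $\rho$. A countable family $(\vartheta_j)_{j\in J}$ of linear operators on $\widehat V$, each preserving every $\widehat N_k$, is pro-summable if for all $k$ and $v$ only finitely many $j$ have $\vartheta_j(v)\notin\widehat N_k$; its sum is then defined by $\pi_m\big(\sum_j\vartheta_j(v)\big)=\sum_j\pi_m(\vartheta_j(v))$. Let $V$ be standard graded and let $x=\sum_{k\ge1}x_k\in\widehat{\mathfrak n}^+$ with $x_k\in\mathfrak g_k$. Then: (1) The series $\exp(\rho(x))=\sum_{p\ge0}\rho(x)^p/p!$ is pro-summable. So is its expansion, the family of the operators $\frac1{m!}\rho(x_{j_m})\cdots\rho(x_{j_1})$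 over all finite sequences $(j_1,\dots,j_m)$ of positive integers ($m\ge0$), and its sum is $\exp(\rho(x))$. If $v\in\widehat V$ and $N\in\mathbb Z$ satisfy $v_i=0$ for all $i<N$ (for example $N$ the order of $v\ne0$), then for all $k\in\mathbb Z$ $$\pi_k(\exp(\rho(x))\cdot v)=v_k+\sum_{n=1}^{k-N}\ \sum_{\substack{m>0,\ j_1,\dots,j_m>0\\ j_1+\cdots+j_m=n}}\frac{x_{j_m}\cdots x_{j_1}}{m!}\cdot v_{k-n}.$$ The operator $\exp(\rho(x))$ lies in $GL(\widehat V)$. (2) For every $n_0\ge1$ the ordered product $\prod_{j=n_0}^\infty\exp(\rho(x_j)):=\lim_{r\to\infty}\exp(\rho(x_r))\cdots\exp(\rho(x_{n_0+1}))\exp(\rho(x_{n_0}))$ exists and is unique, as a limit for pointwise convergence on $\widehat V$, where $\widehat V$ carries the topology induced from the product of the finite dimensional spaces $V_m$. The family of the operators $\frac{\rho(x_{j_m})^{n_m}\cdots\rho(x_{j_1})^{n_1}}{n_1!\cdots n_m!}$ over all $m\ge0$, $n_0\le j_1<\dots<j_m$ and $n_1,\dots,n_m>0$ is pro-summable with this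 product as its sum, and for $v$, $N$, $k$ as in (1) $$\pi_k\Big(\prod_{j=n_0}^\infty\exp(\rho(x_j))\cdot v\Big)=v_k+\sum_{n=1}^{k-N}\ \sum_{\substack{m,n_1,\dots,n_m>0,\ n_0\le j_1<\dots<j_m\\ n_1j_1+\cdots+n_mj_m=n}}\frac{x_{j_m}^{n_m}\cdots x_{j_1}^{n_1}}{n_1!\cdots n_m!}\cdot v_{k-n}.$$ This product lies in $GL(\widehat V)$. (3) If $V=\mathfrak g$ is the adjoint module (with any $f$ making it standard graded), then $\exp(\mathrm{ad}(x))$ and $\prod_{j=n_0}^\infty\exp(\mathrm{ad}(x_j))$, for every $n_0\ge1$, are automorphisms of the Lie algebra $\widehat{\mathfrak g}$. -/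

import Mathlib

open scoped Nat Topology

set_option linter.unusedSectionVars false

noncomputable section

/-! ## Completions of graded Lie algebras and graded modules -/

/-- A family `𝒢` of subspaces of a Lie algebra `L` and a family `𝒱` of subspaces of an `L`-module
with `[𝒢 i, 𝒱 j] ⊆ 𝒱 (i + j)`. -/
class GradedAction {L V : Type*} [LieRing L] [LieAlgebra ℂ L] [AddCommGroup V] [Module ℂ V]
    [LieRingModule L V] (𝒢 : ℤ → Submodule ℂ L) (𝒱 : ℤ → Submodule ℂ V) : Prop where
  lie_mem : ∀ {i j : ℤ} {x : L} {v : V}, x ∈ 𝒢 i → v ∈ 𝒱 j → ⁅x, v⁆ ∈ 𝒱 (i + j)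

/-- The sequences `(v_m)` with `v_m ∈ 𝒱 m` that vanish for all sufficiently negative `m`. -/
def completionSubmodule {V : Type*} [AddCommGroup V] [Module ℂ V] (𝒱 : ℤ → Submodule ℂ V) :
    Submodule ℂ (∀ m : ℤ, 𝒱 m) where
  carrier := {v | ∃ N : ℤ, ∀ m < N, v m = 0}
  zero_mem' := ⟨0, fun _ _ => rfl⟩
  add_mem' := by
    rintro v w ⟨M, hM⟩ ⟨N, hN⟩
    refine ⟨min M N, fun m hm => ?_⟩
    simp [hM m (lt_of_lt_of_le hm (min_le_left _ _)), hN m (lt_of_lt_of_le hm (min_le_right _ _))]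
  smul_mem' := by
    rintro c v ⟨M, hM⟩
    exact ⟨M, fun m hm => by simp [hM m hm]⟩

/-- The positive formal completion `⨁_{m < 0} 𝒱 m ⊕ ∏_{m ≥ 0} 𝒱 m`. -/
def Completion {V : Type*} [AddCommGroup V] [Module ℂ V] (𝒱 : ℤ → Submodule ℂ V) : Type _ :=
  completionSubmodule 𝒱

namespace Completion

section Module

variable {V : Type*} [AddCommGroup V] [Module ℂ V] {𝒱 : ℤ → Submodule ℂ V}

instance : AddCommGroup (Completion 𝒱) := inferInstanceAs (AddCommGroup (completionSubmodule 𝒱))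

instance : Module ℂ (Completion 𝒱) := inferInstanceAs (Module ℂ (completionSubmodule 𝒱))

/-- The projection `π_m` onto the component of degree `m`. -/
def proj (m : ℤ) : Completion 𝒱 →ₗ[ℂ] 𝒱 m :=
  (LinearMap.proj m).comp (completionSubmodule 𝒱).subtype

/-- The component of degree `m`, as an element of `V`. -/
def coeff (m : ℤ) : Completion 𝒱 →ₗ[ℂ] V := (𝒱 m).subtype.comp (proj m)

theorem coeff_mem (m : ℤ) (v : Completion 𝒱) : coeff m v ∈ 𝒱 m := (proj m v).2

theorem coeff_eq_zero_iff {m : ℤ} {v : Completion 𝒱} : coeff m v = 0 ↔ proj m v = 0 :=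
  Submodule.coe_eq_zero

theorem ext {v w : Completion 𝒱} (h : ∀ m, coeff m v = coeff m w) : v = w :=
  Subtype.ext (funext fun m => Subtype.ext (h m))

theorem bounded (v : Completion 𝒱) : ∃ N : ℤ, ∀ m < N, coeff m v = 0 := by
  obtain ⟨N, hN⟩ := v.2
  exact ⟨N, fun m hm => coeff_eq_zero_iff.2 (hN m hm)⟩

/-- The element with given components. -/
def mk (v : ∀ m : ℤ, 𝒱 m) (hv : ∃ N : ℤ, ∀ m < N, v m = 0) : Completion 𝒱 := ⟨v, hv⟩

@[simp] theorem proj_mk (v : ∀ m : ℤ, 𝒱 m) (hv : ∃ N : ℤ, ∀ m < N, v m = 0) (m : ℤ) :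
    proj m (mk v hv) = v m := rfl

/-- The inclusion of the component of degree `k` in the completion. -/
def single (k : ℤ) (v : 𝒱 k) : Completion 𝒱 :=
  mk (Pi.single k v) ⟨k, fun _ hm => Pi.single_eq_of_ne (M := fun m => 𝒱 m) hm.ne v⟩

variable (𝒱) in
/-- The subspace `∏_{m ≥ k} 𝒱 m`, that is, the sequences supported in degrees `≥ k`. -/
def tail (k : ℤ) : Submodule ℂ (Completion 𝒱) where
  carrier := {v | ∀ m < k, coeff m v = 0}
  zero_mem' := fun m _ => map_zero (coeff m)
  add_mem' := fun hv hw m hm => by rw [map_add, hv m hm, hw m hm, add_zero]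
  smul_mem' := fun c v hv m hm => by rw [map_smul, hv m hm, smul_zero]

/-- The topology induced from the product `∏_m 𝒱 m`, where each component carries the canonical
topology of a complex vector space (the usual one when it is finite dimensional). -/
instance : TopologicalSpace (Completion 𝒱) :=
  TopologicalSpace.induced (fun v m => proj m v)
    (@Pi.topologicalSpace ℤ (fun m => 𝒱 m) (fun m => moduleTopology ℂ (𝒱 m)))

end Module

section Action

variable {L V : Type*} [LieRing L] [LieAlgebra ℂ L] [AddCommGroup V] [Module ℂ V]
  [LieRingModule L V] [LieModule ℂ L V]
  {𝒢 : ℤ → Submodule ℂ L} {𝒱 : ℤ → Submodule ℂ V}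

theorem finite_support_lie (x : Completion 𝒢) (v : Completion 𝒱) (k : ℤ) :
    (fun i : ℤ => ⁅coeff i x, coeff (k - i) v⁆).HasFiniteSupport := by
  obtain ⟨a, ha⟩ := x.bounded
  obtain ⟨b, hb⟩ := v.bounded
  refine (Set.finite_Icc a (k - b)).subset fun i hi => ?_
  by_contra h
  apply hi
  rcases lt_or_ge i a with h1 | h1
  · simp [ha i h1]
  · have : k - i < b := by
      by_contra h2
      exact h ⟨h1, by linarith⟩
    simp [hb _ this]

variable [GradedAction 𝒢 𝒱]

/-- The action of the completion of `L` on the completion of `V`, with components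
`π_k (x · v) = ∑_i x_i · v_{k - i}` (a finite sum). -/
def act (x : Completion 𝒢) (v : Completion 𝒱) : Completion 𝒱 :=
  mk (fun k => ⟨∑ᶠ i : ℤ, ⁅coeff i x, coeff (k - i) v⁆,
      finsum_induction (· ∈ 𝒱 k) (zero_mem _) (fun _ _ => add_mem) fun i => by
        have h := GradedAction.lie_mem (𝒢 := 𝒢) (𝒱 := 𝒱) (coeff_mem i x) (coeff_mem (k - i) v)
        rwa [add_sub_cancel] at h⟩)
    (by
      obtain ⟨a, ha⟩ := x.bounded
      obtain ⟨b, hb⟩ := v.bounded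
      refine ⟨a + b, fun k hk => Subtype.ext (finsum_eq_zero_of_forall_eq_zero fun i => ?_)⟩
      rcases lt_or_ge i a with h1 | h1
      · simp [ha i h1]
      · simp [hb (k - i) (by linarith)])

theorem coeff_act (x : Completion 𝒢) (v : Completion 𝒱) (k : ℤ) :
    coeff k (act x v) = ∑ᶠ i : ℤ, ⁅coeff i x, coeff (k - i) v⁆ := rfl

theorem act_add (x : Completion 𝒢) (v w : Completion 𝒱) :
    act x (v + w) = act x v + act x w := by
  refine ext fun k => ?_
  simp only [map_add, coeff_act, lie_add]
  exact finsum_add_distrib (finite_support_lie x v k) (finite_support_lie x w k)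

theorem add_act (x y : Completion 𝒢) (v : Completion 𝒱) :
    act (x + y) v = act x v + act y v := by
  refine ext fun k => ?_
  simp only [map_add, coeff_act, add_lie]
  exact finsum_add_distrib (finite_support_lie x v k) (finite_support_lie y v k)

theorem act_smul (c : ℂ) (x : Completion 𝒢) (v : Completion 𝒱) :
    act x (c • v) = c • act x v := by
  refine ext fun k => ?_
  simp only [map_smul, coeff_act, lie_smul]
  exact (smul_finsum c _).symm

theorem smul_act (c : ℂ) (x : Completion 𝒢) (v : Completion 𝒱) :
    act (c • x) v = c • act x v := by
  refine ext fun k => ?_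
  simp only [map_smul, coeff_act, smul_lie]
  exact (smul_finsum c _).symm

theorem finite_support_lie_lie (x y : Completion 𝒢) (v : Completion 𝒱) (k : ℤ) :
    {p : ℤ × ℤ | ¬ (coeff p.1 x = 0 ∨ coeff p.2 y = 0 ∨ coeff (k - p.1 - p.2) v = 0)}.Finite := by
  obtain ⟨a, ha⟩ := x.bounded
  obtain ⟨b, hb⟩ := y.bounded
  obtain ⟨c, hc⟩ := v.bounded
  refine ((Set.finite_Icc a (k - b - c)).prod (Set.finite_Icc b (k - a - c))).subset ?_
  rintro ⟨i, j⟩ h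
  simp only [Set.mem_ofPred_eq, not_or] at h
  have h1 : a ≤ i := not_lt.1 fun h' => h.1 (ha i h')
  have h2 : b ≤ j := not_lt.1 fun h' => h.2.1 (hb j h')
  have h3 : c ≤ k - i - j := not_lt.1 fun h' => h.2.2 (hc _ h')
  exact ⟨⟨h1, by linarith⟩, ⟨h2, by linarith⟩⟩

theorem coeff_act_act (x y : Completion 𝒢) (v : Completion 𝒱) (k : ℤ) :
    coeff k (act x (act y v)) =
      ∑ᶠ p : ℤ × ℤ, ⁅coeff p.1 x, ⁅coeff p.2 y, coeff (k - p.1 - p.2) v⁆⁆ := by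
  rw [finsum_curry, coeff_act]
  · refine finsum_congr fun i => ?_
    rw [coeff_act]
    exact (LieModule.toEnd ℂ L V (coeff i x)).toAddMonoidHom.map_finsum
      (finite_support_lie y v (k - i))
  · refine (finite_support_lie_lie x y v k).subset fun p hp h => hp ?_
    rcases h with h | h | h <;> simp [h]

theorem coeff_act_act_left [GradedAction 𝒢 𝒢] (x y : Completion 𝒢) (v : Completion 𝒱) (k : ℤ) :
    coeff k (act (act x y) v) =
      ∑ᶠ p : ℤ × ℤ, ⁅⁅coeff p.1 x, coeff p.2 y⁆, coeff (k - p.1 - p.2) v⁆ := by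
  let e : ℤ × ℤ ≃ ℤ × ℤ :=
    { toFun := fun p => (p.2, p.1 - p.2)
      invFun := fun p => (p.1 + p.2, p.1)
      left_inv := fun p => by simp
      right_inv := fun p => by simp }
  have hfin : (fun p : ℤ × ℤ => ⁅⁅coeff p.1 x, coeff p.2 y⁆,
      coeff (k - p.1 - p.2) v⁆).HasFiniteSupport := by
    refine (finite_support_lie_lie x y v k).subset fun p hp h => hp ?_
    rcases h with h | h | h <;> simp [h]
  rw [← finsum_comp_equiv e, finsum_curry, coeff_act]
  · refine finsum_congr fun s => ?_
    rw [coeff_act]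
    have h := (AddMonoidHom.mk' (fun l : L => ⁅l, coeff (k - s) v⁆)
      fun l l' => add_lie l l' _).map_finsum
      (finite_support_lie x y s)
    refine h.trans (finsum_congr fun i => ?_)
    have : k - i - (s - i) = k - s := by ring
    simp only [e, Equiv.coe_fn_mk, this, AddMonoidHom.mk'_apply]
  · exact hfin.preimage e.injective.injOn

theorem act_leibniz [GradedAction 𝒢 𝒢] (x y : Completion 𝒢) (v : Completion 𝒱) :
    act x (act y v) = act (act x y) v + act y (act x v) := by
  refine ext fun k => ?_
  rw [map_add, coeff_act_act, coeff_act_act_left, coeff_act_act,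
    ← finsum_comp_equiv (Equiv.prodComm ℤ ℤ)
      (f := fun p : ℤ × ℤ => ⁅coeff p.1 y, ⁅coeff p.2 x, coeff (k - p.1 - p.2) v⁆⁆),
    ← finsum_add_distrib]
  · refine finsum_congr fun p => ?_
    simp only [Equiv.prodComm_apply, Prod.fst_swap, Prod.snd_swap]
    rw [sub_right_comm k p.2 p.1]
    exact leibniz_lie _ _ _
  · refine (finite_support_lie_lie x y v k).subset fun p hp h => hp ?_
    rcases h with h | h | h <;> simp [h]
  · refine (finite_support_lie_lie x y v k).subset fun p hp h => hp ?_
    simp only [Equiv.prodComm_apply, Prod.fst_swap, Prod.snd_swap]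
    rw [sub_right_comm k p.2 p.1]
    rcases h with h | h | h <;> simp [h]

theorem act_self [GradedAction 𝒢 𝒢] (x : Completion 𝒢) : act x x = 0 := by
  refine ext fun k => ?_
  rw [coeff_act, map_zero]
  have h1 : ∑ᶠ i : ℤ, ⁅coeff i x, coeff (k - i) x⁆ =
      ∑ᶠ i : ℤ, ⁅coeff (k - i) x, coeff i x⁆ := by
    rw [← finsum_comp_equiv (Equiv.subLeft k)]
    refine finsum_congr fun i => ?_
    simp only [Equiv.subLeft_apply, sub_sub_cancel]
  have h2 : ∑ᶠ i : ℤ, ⁅coeff (k - i) x, coeff i x⁆ =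
      -∑ᶠ i : ℤ, ⁅coeff i x, coeff (k - i) x⁆ := by
    rw [← finsum_neg_distrib]
    exact finsum_congr fun i => (lie_skew _ _).symm
  have h3 := h1.trans h2
  rw [eq_neg_iff_add_eq_zero, ← two_smul ℂ] at h3
  exact (smul_eq_zero.1 h3).resolve_left two_ne_zero

/-- The Lie algebra structure on the completion of a graded Lie algebra. -/
instance [GradedAction 𝒢 𝒢] : LieRing (Completion 𝒢) where
  bracket := act
  add_lie := add_act
  lie_add := act_add
  lie_self := act_self
  leibniz_lie := act_leibniz

instance [GradedAction 𝒢 𝒢] : LieAlgebra ℂ (Completion 𝒢) where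
  lie_smul := act_smul

/-- The representation of the completed Lie algebra on the completed module. -/
instance [GradedAction 𝒢 𝒢] : LieRingModule (Completion 𝒢) (Completion 𝒱) where
  bracket := act
  add_lie := add_act
  lie_add := act_add
  leibniz_lie := act_leibniz

instance [GradedAction 𝒢 𝒢] : LieModule ℂ (Completion 𝒢) (Completion 𝒱) where
  smul_lie := smul_act
  lie_smul := act_smul

theorem lie_def [GradedAction 𝒢 𝒢] (x : Completion 𝒢) (v : Completion 𝒱) : ⁅x, v⁆ = act x v := rfl

/-- For the adjoint module, the representation above is the bracket of the completed Lie algebra. -/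
theorem toEnd_self [GradedAction 𝒢 𝒢] (x y : Completion 𝒢) :
    LieModule.toEnd ℂ (Completion 𝒢) (Completion 𝒢) x y =
      @Bracket.bracket _ _ (LieRing.toBracket) x y := rfl

end Action

section ProSummable

variable {V : Type*} [AddCommGroup V] [Module ℂ V] {𝒱 : ℤ → Submodule ℂ V}

/-- A countable family of operators that preserve all the subspaces `tail 𝒱 k` is pro-summable when
the induced family on each quotient by `tail 𝒱 k` is summable: only finitely many of the induced
operators are nonzero on any given vector. (An induced operator kills the class of `v` exactly when
the operator itself sends `v` into `tail 𝒱 k`.) -/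
structure ProSummable {J : Type*} [Countable J] (θ : J → Module.End ℂ (Completion 𝒱)) : Prop where
  map_tail : ∀ (j : J) (k : ℤ), ∀ v ∈ tail 𝒱 k, θ j v ∈ tail 𝒱 k
  finite : ∀ (k : ℤ) (v : Completion 𝒱), {j : J | θ j v ∉ tail 𝒱 k}.Finite

theorem ProSummable.finite_support {J : Type*} [Countable J]
    {θ : J → Module.End ℂ (Completion 𝒱)} (h : ProSummable θ) (m : ℤ) (v : Completion 𝒱) :
    (fun j : J => coeff m (θ j v)).HasFiniteSupport :=
  (h.finite (m + 1) v).subset fun _ hj hmem => hj (hmem m (lt_add_one m))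

open Classical in
/-- The sum of a pro-summable family: `π_m ((∑ θ_j) v) = ∑ π_m (θ_j v)`, a finite sum for each `m`.
It is zero by convention for families that are not pro-summable. -/
def proSum {J : Type*} [Countable J] (θ : J → Module.End ℂ (Completion 𝒱)) :
    Module.End ℂ (Completion 𝒱) :=
  if h : ProSummable θ then
    { toFun := fun v => mk (fun m => ⟨∑ᶠ j : J, coeff m (θ j v),
          finsum_induction (· ∈ 𝒱 m) (zero_mem _) (fun _ _ => add_mem) fun j => coeff_mem m _⟩)
        (by
          obtain ⟨N, hN⟩ := v.bounded
          exact ⟨N, fun m hm => Subtype.ext (finsum_eq_zero_of_forall_eq_zero fun j =>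
            h.map_tail j N v hN m hm)⟩)
      map_add' := fun v w => ext fun m => by
        have := finsum_add_distrib (h.finite_support m v) (h.finite_support m w)
        simp only [← map_add] at this
        exact this
      map_smul' := fun c v => ext fun m => by
        have := smul_finsum c fun j : J => coeff m (θ j v)
        simp only [← map_smul] at this
        exact this.symm }
  else 0

theorem coeff_proSum {J : Type*} [Countable J] {θ : J → Module.End ℂ (Completion 𝒱)}
    (h : ProSummable θ) (m : ℤ) (v : Completion 𝒱) :
    coeff m (proSum θ v) = ∑ᶠ j : J, coeff m (θ j v) := by
  rw [proSum, dif_pos h]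
  rfl

end ProSummable

section Expansions

/-- For `c = (j_1, …, j_m)` the operator `(1 / m!) T_{j_m} ⋯ T_{j_1}`. -/
def compositionTerm {W : Type*} [AddCommGroup W] [Module ℂ W] (T : ℕ → Module.End ℂ W) {n : ℕ}
    (c : Composition n) : Module.End ℂ W :=
  (c.length ! : ℂ)⁻¹ • (c.blocks.map T).reverse.prod

/-- The partitions of `n` with all parts at least `n₀`. -/
abbrev PartitionGE (n₀ n : ℕ) : Type := {p : n.Partition // ∀ j ∈ p.parts, n₀ ≤ j}

/-- For a partition with distinct parts `j_1 < ⋯ < j_m` of multiplicities `n_1, …, n_m`, the operator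
`(T_{j_m} ^ n_m / n_m!) ⋯ (T_{j_1} ^ n_1 / n_1!)`. -/
def partitionTerm {W : Type*} [AddCommGroup W] [Module ℂ W] (T : ℕ → Module.End ℂ W) {n : ℕ}
    (p : n.Partition) : Module.End ℂ W :=
  ((p.parts.toFinset.sort (· ≥ ·)).map fun j =>
    ((p.parts.count j)! : ℂ)⁻¹ • T j ^ p.parts.count j).prod

end Expansions

section Exponentials

variable {L V : Type*} [LieRing L] [LieAlgebra ℂ L] [AddCommGroup V] [Module ℂ V]
  [LieRingModule L V] [LieModule ℂ L V]
  {𝒢 : ℤ → Submodule ℂ L} (𝒱 : ℤ → Submodule ℂ V) [GradedAction 𝒢 𝒢] [GradedAction 𝒢 𝒱]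

/-- The terms `ρ(x) ^ p / p!` of the exponential series on the completed module. -/
def expSeries (x : Completion 𝒢) (p : ℕ) : Module.End ℂ (Completion 𝒱) :=
  (p ! : ℂ)⁻¹ • LieModule.toEnd ℂ (Completion 𝒢) (Completion 𝒱) x ^ p

/-- The operator `exp (ρ(x))` on the completed module. -/
def expRho (x : Completion 𝒢) : Module.End ℂ (Completion 𝒱) := proSum (expSeries 𝒱 x)

/-- The homogeneous component `x_j`, as an element of the completed Lie algebra. -/
def component (x : Completion 𝒢) (j : ℕ) : Completion 𝒢 := single (j : ℤ) (proj (j : ℤ) x)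

/-- The operator `ρ(x_j)` on the completed module. -/
def rhoHat (x : Completion 𝒢) (j : ℕ) : Module.End ℂ (Completion 𝒱) :=
  LieModule.toEnd ℂ (Completion 𝒢) (Completion 𝒱) (component x j)

/-- The product of the first `r` factors of the ordered product starting at `n₀`:
`exp (ρ(x_{n₀ + r - 1})) ⋯ exp (ρ(x_{n₀ + 1})) exp (ρ(x_{n₀}))`. -/
def partialProd (x : Completion 𝒢) (n₀ : ℕ) : ℕ → Module.End ℂ (Completion 𝒱)
  | 0 => 1
  | r + 1 => expRho 𝒱 (component x (n₀ + r)) * partialProd x n₀ r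

/-- `P` is the infinite ordered product `⋯ exp (ρ(x_{n₀ + 1})) exp (ρ(x_{n₀}))`: the limit of the
finite products in the topology of pointwise convergence. -/
def IsOrderedProd (x : Completion 𝒢) (n₀ : ℕ) (P : Module.End ℂ (Completion 𝒱)) : Prop :=
  ∀ v : Completion 𝒱, Filter.Tendsto (fun r => partialProd 𝒱 x n₀ r v) Filter.atTop (𝓝 (P v))

/-- The expansion of `exp (ρ(x))` into monomials in the `ρ(x_j)`. -/
def expExpansion (x : Completion 𝒢) (c : Σ n : ℕ, Composition n) : Module.End ℂ (Completion 𝒱) :=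
  compositionTerm (rhoHat 𝒱 x) c.2

/-- The expansion of the ordered product starting at `n₀` into monomials in the `ρ(x_j)`. -/
def prodExpansion (x : Completion 𝒢) (n₀ : ℕ) (p : Σ n : ℕ, PartitionGE n₀ n) :
    Module.End ℂ (Completion 𝒱) :=
  partitionTerm (rhoHat 𝒱 x) p.2.1

end Exponentials

end Completion

/-! ## Kac–Moody algebras and standard graded modules -/

namespace KacMoody

open Module (Dual)

/-- Generalized Cartan matrices. -/
structure IsGCM {ℓ : ℕ} (A : Matrix (Fin ℓ) (Fin ℓ) ℤ) : Prop where
  diag : ∀ i, A i i = 2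
  off_diag : ∀ i j, i ≠ j → A i j ≤ 0
  zero : ∀ i j, A i j = 0 → A j i = 0

/-- Symmetrizability: `diag(d) A` is symmetric for some positive rational numbers `d_i`. -/
def IsSymmetrizable {ℓ : ℕ} (A : Matrix (Fin ℓ) (Fin ℓ) ℤ) : Prop :=
  ∃ d : Fin ℓ → ℚ, (∀ i, 0 < d i) ∧ (Matrix.diagonal d * A.map (fun a : ℤ => (a : ℚ))).IsSymm

/-- A realization of `A` on the complex vector space `𝔥`. -/
structure Realization {ℓ : ℕ} (A : Matrix (Fin ℓ) (Fin ℓ) ℤ) (𝔥 : Type*) [AddCommGroup 𝔥]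
    [Module ℂ 𝔥] where
  /-- The simple roots. -/
  root : Fin ℓ → Dual ℂ 𝔥
  /-- The simple coroots. -/
  coroot : Fin ℓ → 𝔥
  finite : Module.Finite ℂ 𝔥
  finrank_add_rank : Module.finrank ℂ 𝔥 + (A.map (fun a : ℤ => (a : ℂ))).rank = 2 * ℓ
  root_indep : LinearIndependent ℂ root
  coroot_indep : LinearIndependent ℂ coroot
  pairing : ∀ i j, root j (coroot i) = (A i j : ℂ)

/-- The generators `𝔥 ∪ {e_i, f_i}`. -/
inductive Generator (ℓ : ℕ) (𝔥 : Type*) : Type _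
  | h : 𝔥 → Generator ℓ 𝔥
  | e : Fin ℓ → Generator ℓ 𝔥
  | f : Fin ℓ → Generator ℓ 𝔥

section Algebra

variable {ℓ : ℕ} {A : Matrix (Fin ℓ) (Fin ℓ) ℤ} {𝔥 : Type*} [AddCommGroup 𝔥] [Module ℂ 𝔥]

/-- The free Lie algebra on the generators. -/
abbrev Free (ℓ : ℕ) (𝔥 : Type*) : Type _ := FreeLieAlgebra ℂ (Generator ℓ 𝔥)

/-- The generator of the free Lie algebra given by an element of `𝔥`. -/
def genH (ℓ : ℕ) {𝔥 : Type*} (x : 𝔥) : Free ℓ 𝔥 := FreeLieAlgebra.of ℂ (Generator.h x)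

/-- The generator `e_i` of the free Lie algebra. -/
def genE {ℓ : ℕ} (𝔥 : Type*) (i : Fin ℓ) : Free ℓ 𝔥 := FreeLieAlgebra.of ℂ (Generator.e i)

/-- The generator `f_i` of the free Lie algebra. -/
def genF {ℓ : ℕ} (𝔥 : Type*) (i : Fin ℓ) : Free ℓ 𝔥 := FreeLieAlgebra.of ℂ (Generator.f i)

/-- The defining relations; an element `z` with `Relator R z` is set to zero. The first two say that
`𝔥` is included as a vector space. -/
inductive Relator (R : Realization A 𝔥) : Free ℓ 𝔥 → Prop
  | h_add (x y : 𝔥) : Relator R (genH ℓ (x + y) - genH ℓ x - genH ℓ y)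
  | h_smul (c : ℂ) (x : 𝔥) : Relator R (genH ℓ (c • x) - c • genH ℓ x)
  | h_h (x y : 𝔥) : Relator R ⁅genH ℓ x, genH ℓ y⁆
  | h_e (x : 𝔥) (i : Fin ℓ) : Relator R (⁅genH ℓ x, genE 𝔥 i⁆ - R.root i x • genE 𝔥 i)
  | h_f (x : 𝔥) (i : Fin ℓ) : Relator R (⁅genH ℓ x, genF 𝔥 i⁆ + R.root i x • genF 𝔥 i)
  | e_f (i : Fin ℓ) : Relator R (⁅genE 𝔥 i, genF 𝔥 i⁆ - genH ℓ (R.coroot i))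
  | e_f_ne (i j : Fin ℓ) (hij : i ≠ j) : Relator R ⁅genE 𝔥 i, genF 𝔥 j⁆
  | serre_e (i j : Fin ℓ) (hij : i ≠ j) :
      Relator R ((LieAlgebra.ad ℂ (Free ℓ 𝔥) (genE 𝔥 i) ^ (1 - A i j).toNat) (genE 𝔥 j))
  | serre_f (i j : Fin ℓ) (hij : i ≠ j) :
      Relator R ((LieAlgebra.ad ℂ (Free ℓ 𝔥) (genF 𝔥 i) ^ (1 - A i j).toNat) (genF 𝔥 j))

/-- The ideal generated by the defining relations. -/
def relatorIdeal (R : Realization A 𝔥) : LieIdeal ℂ (Free ℓ 𝔥) :=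
  LieSubmodule.lieSpan ℂ (Free ℓ 𝔥) {z | Relator R z}

/-- The Kac–Moody algebra of `A`, for a given realization. -/
def KMAlgebra (R : Realization A 𝔥) : Type _ := Free ℓ 𝔥 ⧸ relatorIdeal R

instance (R : Realization A 𝔥) : LieRing (KMAlgebra R) :=
  inferInstanceAs (LieRing (Free ℓ 𝔥 ⧸ relatorIdeal R))

instance (R : Realization A 𝔥) : LieAlgebra ℂ (KMAlgebra R) :=
  inferInstanceAs (LieAlgebra ℂ (Free ℓ 𝔥 ⧸ relatorIdeal R))

/-- The canonical map from `𝔥` to the Kac–Moody algebra. -/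
def cartan (R : Realization A 𝔥) (x : 𝔥) : KMAlgebra R :=
  LieSubmodule.Quotient.mk' (relatorIdeal R) (genH ℓ x)

end Algebra

section Weights

variable {ℓ : ℕ} {A : Matrix (Fin ℓ) (Fin ℓ) ℤ} {𝔥 : Type*} [AddCommGroup 𝔥] [Module ℂ 𝔥]
  (R : Realization A 𝔥)

/-- The weight space `V_μ`. -/
def weightSpace (V : Type*) [AddCommGroup V] [Module ℂ V] [LieRingModule (KMAlgebra R) V]
    [LieModule ℂ (KMAlgebra R) V] (μ : Dual ℂ 𝔥) : Submodule ℂ V where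
  carrier := {v | ∀ x : 𝔥, ⁅cartan R x, v⁆ = μ x • v}
  zero_mem' := fun x => by simp
  add_mem' := fun hv hw x => by rw [lie_add, hv x, hw x, smul_add]
  smul_mem' := fun c v hv x => by rw [lie_smul, hv x, smul_comm]

/-- The weights of `V`. -/
def weights (V : Type*) [AddCommGroup V] [Module ℂ V] [LieRingModule (KMAlgebra R) V]
    [LieModule ℂ (KMAlgebra R) V] : Set (Dual ℂ 𝔥) :=
  {μ | weightSpace R V μ ≠ ⊥}

/-- The roots: the nonzero weights of the adjoint module. -/
def roots : Set (Dual ℂ 𝔥) := {α | α ≠ 0 ∧ α ∈ weights R (KMAlgebra R)}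

/-- The monoid `Q⁺` of sums of simple roots. -/
def posCone : AddSubmonoid (Dual ℂ 𝔥) := AddSubmonoid.closure (Set.range R.root)

/-- The positive roots. -/
def posRoots : Set (Dual ℂ 𝔥) := {α | α ∈ roots R ∧ α ∈ posCone R}

/-- The negative roots. -/
def negRoots : Set (Dual ℂ 𝔥) := {α | α ∈ roots R ∧ -α ∈ posCone R}

/-- The dominance order `μ ≤ lam`. -/
def DominanceLE (μ lam : Dual ℂ 𝔥) : Prop := lam - μ ∈ posCone R

/-- Restricted weight lattices. -/
structure IsRestrictedWeightLattice (P : AddSubgroup (Dual ℂ 𝔥)) : Prop where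
  root_mem : ∀ i, R.root i ∈ P
  integral : ∀ μ ∈ P, ∀ i, ∃ z : ℤ, μ (R.coroot i) = z
  /-- `P` contains a minimal regular weight. -/
  regular : ∃ μ ∈ P, ∀ i, μ (R.coroot i) = 1
  /-- Some fundamental weights extend to a family that is both a `ℤ`-basis of `P` and a `ℂ`-basis of
  the dual of `𝔥` (such a family is automatically independent over `ℤ`). -/
  exists_basis : ∃ (r : ℕ) (b : Module.Basis (Fin ℓ ⊕ Fin r) ℂ (Dual ℂ 𝔥)),
    (∀ i j, b (Sum.inl i) (R.coroot j) = if i = j then 1 else 0) ∧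
      AddSubgroup.closure (Set.range b) = P

/-- Weight modules: direct sums of finite dimensional weight spaces. -/
structure IsWeightModule (V : Type*) [AddCommGroup V] [Module ℂ V] [LieRingModule (KMAlgebra R) V]
    [LieModule ℂ (KMAlgebra R) V] : Prop where
  isInternal : open Classical in DirectSum.IsInternal (weightSpace R V)
  finite : ∀ μ, Module.Finite ℂ (weightSpace R V μ)

variable {R} {P : AddSubgroup (Dual ℂ 𝔥)}

/-- The set `Δ_m` of elements of `Δ ∪ {0}` of degree `m`. -/
def rootsOfDegree (R : Realization A 𝔥) (f : P →+ ℤ) (m : ℤ) : Set P :=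
  {α | ((α : Dual ℂ 𝔥) ∈ roots R ∨ α = 0) ∧ f α = m}

/-- The set `wts_m(V)` of weights of degree `m`. -/
def weightsOfDegree (R : Realization A 𝔥) (f : P →+ ℤ) (V : Type*) [AddCommGroup V] [Module ℂ V]
    [LieRingModule (KMAlgebra R) V] [LieModule ℂ (KMAlgebra R) V] (m : ℤ) : Set P :=
  {μ | (μ : Dual ℂ 𝔥) ∈ weights R V ∧ f μ = m}

/-- `V` is a standard graded module with grading function `f`: it is a weight module with weights in
`P`, and the additive function `f` has finite fibres on `Δ ∪ {0}` and on the weights, separates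
positive roots, zero and negative roots by its sign, and has pairwise incomparable weights in each
fibre. -/
structure IsStandardGraded (R : Realization A 𝔥) (f : P →+ ℤ) (V : Type*) [AddCommGroup V]
    [Module ℂ V] [LieRingModule (KMAlgebra R) V] [LieModule ℂ (KMAlgebra R) V] : Prop where
  isWeightModule : IsWeightModule R V
  weights_subset : weights R V ⊆ P
  finite_roots : ∀ m, (rootsOfDegree R f m).Finite
  finite_weights : ∀ m, (weightsOfDegree R f V m).Finite
  pos : ∀ m > 0, ∀ α ∈ rootsOfDegree R f m, (α : Dual ℂ 𝔥) ∈ posRoots R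
  zero : rootsOfDegree R f 0 = {0}
  neg : ∀ m < 0, ∀ α ∈ rootsOfDegree R f m, (α : Dual ℂ 𝔥) ∈ negRoots R
  incomparable : ∀ m, ∀ μ ∈ weightsOfDegree R f V m, ∀ ν ∈ weightsOfDegree R f V m, μ ≠ ν →
    ¬ DominanceLE R μ ν

/-- The component `V_m`, the sum of the weight spaces of the weights of degree `m`. For the adjoint
module this is the component `𝔤_m` of the Kac–Moody algebra. -/
def gradedPiece (R : Realization A 𝔥) (f : P →+ ℤ) (V : Type*) [AddCommGroup V] [Module ℂ V]
    [LieRingModule (KMAlgebra R) V] [LieModule ℂ (KMAlgebra R) V] (m : ℤ) : Submodule ℂ V :=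
  ⨆ (μ : P) (_ : f μ = m), weightSpace R V (μ : Dual ℂ 𝔥)

instance (f : P →+ ℤ) (V : Type*) [AddCommGroup V] [Module ℂ V] [LieRingModule (KMAlgebra R) V]
    [LieModule ℂ (KMAlgebra R) V] :
    GradedAction (gradedPiece R f (KMAlgebra R)) (gradedPiece R f V) where
  lie_mem := by
    intro i j x v hx hv
    have key : ∀ (α μ : P), f α = i → f μ = j → ∀ y ∈ weightSpace R (KMAlgebra R) (α : Dual ℂ 𝔥),
        ∀ w ∈ weightSpace R V (μ : Dual ℂ 𝔥), ⁅y, w⁆ ∈ gradedPiece R f V (i + j) := by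
      intro α μ hα hμ y hy w hw
      refine Submodule.mem_iSup_of_mem (α + μ) (Submodule.mem_iSup_of_mem (by simp [hα, hμ]) ?_)
      intro h
      rw [leibniz_lie, hy h, hw h, smul_lie, lie_smul, AddSubgroup.coe_add, LinearMap.add_apply,
        add_smul]
    have h1 : ∀ (α : P), f α = i → ∀ y ∈ weightSpace R (KMAlgebra R) (α : Dual ℂ 𝔥),
        ∀ w ∈ gradedPiece R f V j, ⁅y, w⁆ ∈ gradedPiece R f V (i + j) := by
      intro α hα y hy
      change gradedPiece R f V j ≤ (gradedPiece R f V (i + j)).comap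
        (LieModule.toEnd ℂ (KMAlgebra R) V y)
      exact iSup₂_le fun μ hμ w hw => key α μ hα hμ y hy w hw
    have h2 : gradedPiece R f (KMAlgebra R) i ≤ (gradedPiece R f V (i + j)).comap
        (LinearMap.flip (LieModule.toEnd ℂ (KMAlgebra R) V : KMAlgebra R →ₗ[ℂ] Module.End ℂ V) v) :=
      iSup₂_le fun α hα y hy => h1 α hα y hy v hv
    exact h2 hx

/-- The completion of the Kac–Moody algebra. -/
abbrev AlgebraHat (R : Realization A 𝔥) (f : P →+ ℤ) : Type _ :=
  Completion (gradedPiece R f (KMAlgebra R))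

/-- The completion of a module. -/
abbrev ModuleHat (R : Realization A 𝔥) (f : P →+ ℤ) (V : Type*) [AddCommGroup V] [Module ℂ V]
    [LieRingModule (KMAlgebra R) V] [LieModule ℂ (KMAlgebra R) V] : Type _ :=
  Completion (gradedPiece R f V)

/-- The subspace `∏_{k ≥ 1} 𝔤_k` of the completed Kac–Moody algebra. -/
def nHat (R : Realization A 𝔥) (f : P →+ ℤ) : Submodule ℂ (AlgebraHat R f) :=
  Completion.tail (gradedPiece R f (KMAlgebra R)) 1

end Weights

end KacMoody

end

/-! The argument takes place for any ℤ-graded Lie algebra acting on a graded module. Everything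
rests on the filtration of the completion by the subspaces `tail`: each vector lies in some `tail 𝒱
N`, and only zero lies in all of them. If `x` has only positive components, `ρ(x)` raises the
filtration by one, and a monomial in the `ρ(x_j)` of total degree `n` raises it by `n`. On `v ∈ tail
𝒱 N`, only monomials with `n ≤ k - N` reach degree `k`, so every series becomes a finite sum there.

The two expansions are therefore finite combinatorics. In degree `k`, powers of `ρ(x)` expand over
lists of positive integers, which are compositions (`proSum_expExpansion`), and partial ordered
products expand over multisets, which are partitions (`coeff_partialProd_eq`). The coefficients of
the partial products are eventually constant, which gives the limit and its uniqueness
(`isOrderedProd_iff`).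

Both operators are the identity plus terms of higher degree, so a geometric series inverts them
(`isUnit_one_sub_of_raisesDegree`).

For the adjoint module, the Leibniz rule makes the truncated exponential respect brackets up to high
order, and separatedness removes the error (`map_lie_of_approx`). Finite products of exponentials
then respect brackets exactly, and so does their limit. -/

namespace Completion

/-! ### The filtration by tails: summability, invertibility, limits -/

section Filtration

variable {V : Type*} [AddCommGroup V] [Module ℂ V] {𝒱 : ℤ → Submodule ℂ V}

theorem tail_anti {k l : ℤ} (h : k ≤ l) : tail 𝒱 l ≤ tail 𝒱 k :=
  fun _ hv m hm => hv m (hm.trans_le h)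

theorem exists_mem_tail (v : Completion 𝒱) : ∃ N : ℤ, v ∈ tail 𝒱 N := v.bounded

/-- The filtration by the subspaces `tail` is separated. -/
theorem eq_of_sub_mem_tail {v w : Completion 𝒱} (N : ℤ)
    (h : ∀ m : ℕ, v - w ∈ tail 𝒱 (N + m)) : v = w := by
  refine ext fun k => sub_eq_zero.1 ?_
  rw [← map_sub]
  exact h (k - N + 1).toNat k (by have := Int.self_le_toNat (k - N + 1); linarith)

/-- The operator `θ` raises the degree of the filtration by at least `d`. -/
def RaisesDegree (d : ℕ) (θ : Module.End ℂ (Completion 𝒱)) : Prop :=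
  ∀ k : ℤ, ∀ v ∈ tail 𝒱 k, θ v ∈ tail 𝒱 (k + d)

theorem RaisesDegree.one : RaisesDegree 0 (1 : Module.End ℂ (Completion 𝒱)) :=
  fun k v hv => by simpa using hv

theorem RaisesDegree.mul {d e : ℕ} {θ η : Module.End ℂ (Completion 𝒱)} (hθ : RaisesDegree d θ)
    (hη : RaisesDegree e η) : RaisesDegree (d + e) (θ * η) := fun k v hv => by
  have := hθ _ _ (hη k v hv)
  rwa [add_assoc, add_comm (e : ℤ), ← Nat.cast_add] at this

theorem RaisesDegree.pow {d : ℕ} {θ : Module.End ℂ (Completion 𝒱)} (hθ : RaisesDegree d θ) (p : ℕ) :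
    RaisesDegree (p * d) (θ ^ p) := by
  induction p with
  | zero => simpa using RaisesDegree.one
  | succ p ih => rw [pow_succ, add_mul, one_mul]; exact ih.mul hθ

theorem RaisesDegree.smul {d : ℕ} {θ : Module.End ℂ (Completion 𝒱)} (c : ℂ)
    (hθ : RaisesDegree d θ) : RaisesDegree d (c • θ) :=
  fun k v hv => (tail 𝒱 _).smul_mem c (hθ k v hv)

/-- If `v` starts in degree `N`, then `θ p v` starts in degree at least `N + p`, so only `p < k - N`
can matter modulo `tail 𝒱 k`. -/
theorem proSummable_of_raisesDegree {θ : ℕ → Module.End ℂ (Completion 𝒱)}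
    (h : ∀ p, RaisesDegree p (θ p)) : ProSummable θ where
  map_tail p k v hv := tail_anti (by simp) (h p k v hv)
  finite k v := by
    obtain ⟨N, hN⟩ := exists_mem_tail v
    refine (Set.finite_lt_nat (k - N).toNat).subset fun p hp => ?_
    by_contra hlt
    refine hp (tail_anti ?_ (h p N v hN))
    have : ¬ p < (k - N).toNat := hlt
    omega

theorem coeff_proSum_of_raisesDegree {θ : ℕ → Module.End ℂ (Completion 𝒱)}
    (h : ∀ p, RaisesDegree p (θ p)) {N k : ℤ} {M : ℕ} (hM : k < N + M) {v : Completion 𝒱}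
    (hv : v ∈ tail 𝒱 N) :
    coeff k (proSum θ v) = ∑ p ∈ Finset.range M, coeff k (θ p v) := by
  rw [coeff_proSum (proSummable_of_raisesDegree h)]
  refine finsum_eq_sum_of_support_subset _ fun p hp => ?_
  by_contra hlt
  refine hp (h p N v hv k ?_)
  have : ¬ p < M := by simpa using hlt
  omega

/-- The error bound depends on `v` only through `N`. This uniformity is what lets identities for
finite sums pass to the infinite sum. -/
theorem proSum_sub_mem_tail {θ : ℕ → Module.End ℂ (Completion 𝒱)}
    (h : ∀ p, RaisesDegree p (θ p)) {N : ℤ} (M : ℕ) {v : Completion 𝒱} (hv : v ∈ tail 𝒱 N) :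
    proSum θ v - ∑ p ∈ Finset.range M, θ p v ∈ tail 𝒱 (N + M) := fun k hk => by
  rw [map_sub, coeff_proSum_of_raisesDegree h hk hv, map_sum, sub_self]

/-- An operator that is the identity up to terms of higher degree is invertible. -/
theorem isUnit_one_sub_of_raisesDegree {U : Module.End ℂ (Completion 𝒱)}
    (hU : RaisesDegree 1 U) : IsUnit (1 - U) := by
  have hp : ∀ p, RaisesDegree p (U ^ p) := fun p => by simpa using hU.pow p
  have h0 : ∀ k : ℤ, ∀ v ∈ tail 𝒱 k, (1 - U) v ∈ tail 𝒱 k := fun k v hv =>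
    (tail 𝒱 k).sub_mem hv (tail_anti (by simp) (hU k v hv))
  -- The inverse is the geometric series. Truncated at `m` it telescopes to `v - U ^ m v`; both `U ^
  -- m v` and the truncation error lie in `tail 𝒱 (N + m)`.
  refine isUnit_iff_exists.2 ⟨proSum fun p => U ^ p, LinearMap.ext fun v => ?_,
    LinearMap.ext fun v => ?_⟩
  all_goals
    obtain ⟨N, hN⟩ := exists_mem_tail v
    refine eq_of_sub_mem_tail N fun m => ?_
  · have h1 := h0 _ _ (proSum_sub_mem_tail hp m hN)
    have h2 := hp m N v hN
    have h3 : (1 - U) (∑ p ∈ Finset.range m, (U ^ p) v) = v - (U ^ m) v := by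
      have := congrArg (fun T : Module.End ℂ (Completion 𝒱) => T v) (mul_neg_geom_sum U m)
      simpa [LinearMap.sum_apply] using this
    rw [map_sub, h3] at h1
    have := (tail 𝒱 _).sub_mem h1 h2
    rwa [sub_sub, sub_add_cancel] at this
  · have h1 := proSum_sub_mem_tail hp m (h0 N v hN)
    have h2 := hp m N v hN
    have h3 : ∑ p ∈ Finset.range m, (U ^ p) ((1 - U) v) = v - (U ^ m) v := by
      have := congrArg (fun T : Module.End ℂ (Completion 𝒱) => T v) (geom_sum_mul_neg U m)
      simpa [LinearMap.sum_apply] using this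
    rw [h3] at h1
    have := (tail 𝒱 _).sub_mem h1 h2
    rwa [sub_sub, sub_add_cancel] at this

theorem isUnit_of_coeff_eq {θ : Module.End ℂ (Completion 𝒱)}
    (h : ∀ N : ℤ, ∀ v ∈ tail 𝒱 N, ∀ k ≤ N, coeff k (θ v) = coeff k v) : IsUnit θ := by
  have hU : RaisesDegree 1 (1 - θ) := fun N v hv k hk => by
    rw [LinearMap.sub_apply, map_sub, Module.End.one_apply,
      h N v hv k (Int.lt_add_one_iff.1 (by simpa using hk)), sub_self]
  simpa using isUnit_one_sub_of_raisesDegree hU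

/-- A sequence whose coefficients are eventually those of `w` converges to `w`, and to nothing else. -/
theorem tendsto_iff_of_eventually_coeff_eq {u : ℕ → Completion 𝒱} {w : Completion 𝒱}
    (h : ∀ k, ∀ᶠ r in Filter.atTop, coeff k (u r) = coeff k w) (z : Completion 𝒱) :
    Filter.Tendsto u Filter.atTop (𝓝 z) ↔ z = w := by
  let : ∀ m, TopologicalSpace (𝒱 m) := fun m => moduleTopology ℂ (𝒱 m)
  have : ∀ m, IsModuleTopology ℂ (𝒱 m) := fun m => ⟨rfl⟩
  have hind : Topology.IsInducing (fun (v : Completion 𝒱) (m : ℤ) => proj m v) := ⟨rfl⟩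
  have h' : ∀ k, ∀ᶠ r in Filter.atTop, proj k (u r) = proj k w := fun k =>
    (h k).mono fun r hr => Subtype.ext hr
  rw [hind.tendsto_nhds_iff, tendsto_pi_nhds]
  constructor
  · intro hz
    refine ext fun k => ?_
    by_contra hne
    -- Linear functionals separate points and are continuous for the module topology, so uniqueness
    -- of limits is inherited from ℂ.
    obtain ⟨g, hg⟩ := Module.Projective.exists_dual_ne_zero ℂ
      (sub_ne_zero.2 fun h0 : proj k z = proj k w => hne (congrArg Subtype.val h0))
    have hcont : Continuous g := IsModuleTopology.continuous_of_linearMap g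
    have h1 : Filter.Tendsto (fun r => g (proj k (u r))) Filter.atTop (𝓝 (g (proj k z))) :=
      (hcont.tendsto _).comp (hz k)
    have h2 : Filter.Tendsto (fun r => g (proj k (u r))) Filter.atTop (𝓝 (g (proj k w))) :=
      tendsto_const_nhds.congr' ((h' k).mono fun r hr => (congrArg g hr).symm)
    exact hg (by rw [map_sub, tendsto_nhds_unique h1 h2, sub_self])
  · rintro rfl k
    exact tendsto_const_nhds.congr' ((h' k).mono fun r hr => hr.symm)

end Filtration

/-! ### Homogeneous operators and sums over degrees -/

section Homogeneous

variable {V : Type*} [AddCommGroup V] [Module ℂ V] {𝒱 : ℤ → Submodule ℂ V}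

/-- The operator `θ` on the completion is homogeneous of degree `n`, and given by the operator `t`
on components. -/
def IsHomogeneous (n : ℕ) (θ : Module.End ℂ (Completion 𝒱)) (t : Module.End ℂ V) : Prop :=
  ∀ (k : ℤ) (v : Completion 𝒱), coeff k (θ v) = t (coeff (k - n) v)

theorem IsHomogeneous.one : IsHomogeneous 0 (1 : Module.End ℂ (Completion 𝒱)) 1 :=
  fun k v => by simp

theorem IsHomogeneous.mul {m n : ℕ} {θ η : Module.End ℂ (Completion 𝒱)} {t s : Module.End ℂ V}
    (hθ : IsHomogeneous m θ t) (hη : IsHomogeneous n η s) :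
    IsHomogeneous (m + n) (θ * η) (t * s) := fun k v => by
  rw [Module.End.mul_apply, hθ, hη, Module.End.mul_apply, Nat.cast_add, sub_sub]

theorem IsHomogeneous.smul {n : ℕ} {θ : Module.End ℂ (Completion 𝒱)} {t : Module.End ℂ V} (c : ℂ)
    (hθ : IsHomogeneous n θ t) : IsHomogeneous n (c • θ) (c • t) := fun k v => by
  rw [LinearMap.smul_apply, map_smul, hθ, LinearMap.smul_apply]

theorem IsHomogeneous.pow {n : ℕ} {θ : Module.End ℂ (Completion 𝒱)} {t : Module.End ℂ V}
    (hθ : IsHomogeneous n θ t) (p : ℕ) : IsHomogeneous (p * n) (θ ^ p) (t ^ p) := by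
  induction p with
  | zero => simpa using IsHomogeneous.one
  | succ p ih => rw [pow_succ, pow_succ, add_mul, one_mul]; exact ih.mul hθ

theorem IsHomogeneous.list_prod {ι : Type*} {d : ι → ℕ} {θ : ι → Module.End ℂ (Completion 𝒱)}
    {t : ι → Module.End ℂ V} (h : ∀ j, IsHomogeneous (d j) (θ j) (t j)) (l : List ι) :
    IsHomogeneous (l.map d).sum (l.map θ).prod (l.map t).prod := by
  induction l with
  | nil => simpa using IsHomogeneous.one
  | cons j l ih => simpa using (h j).mul ih

theorem IsHomogeneous.compositionTerm {θ : ℕ → Module.End ℂ (Completion 𝒱)}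
    {t : ℕ → Module.End ℂ V} (h : ∀ j, IsHomogeneous j (θ j) (t j)) {n : ℕ} (c : Composition n) :
    IsHomogeneous n (compositionTerm θ c) (compositionTerm t c) := by
  refine IsHomogeneous.smul _ ?_
  have := IsHomogeneous.list_prod h c.blocks.reverse
  rwa [List.map_id', List.sum_reverse, c.blocks_sum, List.map_reverse, List.map_reverse] at this

theorem IsHomogeneous.partitionTerm {θ : ℕ → Module.End ℂ (Completion 𝒱)}
    {t : ℕ → Module.End ℂ V} (h : ∀ j, IsHomogeneous j (θ j) (t j)) {n : ℕ} (p : n.Partition) :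
    IsHomogeneous n (partitionTerm θ p) (partitionTerm t p) := by
  have := IsHomogeneous.list_prod (fun j =>
    ((h j).pow (p.parts.count j)).smul ((p.parts.count j)! : ℂ)⁻¹) (p.parts.toFinset.sort (· ≥ ·))
  have hsum : ((p.parts.toFinset.sort (· ≥ ·)).map fun j => p.parts.count j * j).sum = n := by
    conv_rhs => rw [← p.parts_sum, Finset.sum_multiset_count, Finset.sum,
      ← Finset.sort_eq p.parts.toFinset (· ≥ ·), Multiset.map_coe, Multiset.sum_coe]
    rfl
  rwa [hsum] at this

variable {F : ℕ → Type*} [Countable (Σ n, F n)] {θ : (Σ n, F n) → Module.End ℂ (Completion 𝒱)}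
  {t : (Σ n, F n) → Module.End ℂ V}

/-- Only degrees `n < k - N` survive modulo `tail 𝒱 k`, and each degree carries finitely many
operators. -/
theorem proSummable_of_isHomogeneous [∀ n, Finite (F n)]
    (h : ∀ p, IsHomogeneous p.1 (θ p) (t p)) : ProSummable θ where
  map_tail p k v hv m hm := by rw [h p m v, hv _ (by omega), map_zero]
  finite k v := by
    obtain ⟨N, hN⟩ := exists_mem_tail v
    have hfin : (⋃ n ∈ {n | n < (k - N).toNat}, Set.range (Sigma.mk (β := F) n)).Finite :=
      (Set.finite_lt_nat _).biUnion fun n _ => Set.finite_range _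
    refine hfin.subset fun p hp => Set.mem_biUnion (x := p.1) ?_ ⟨p.2, rfl⟩
    by_contra hlt
    have : ¬ p.1 < (k - N).toNat := hlt
    exact hp fun m hm => by rw [h p m v, hN _ (by omega), map_zero]

theorem coeff_proSum_of_isHomogeneous [∀ n, Fintype (F n)]
    (h : ∀ p, IsHomogeneous p.1 (θ p) (t p)) {N k : ℤ} {M : ℕ} (hM : k < N + M)
    {v : Completion 𝒱} (hv : v ∈ tail 𝒱 N) :
    coeff k (proSum θ v) = ∑ n ∈ Finset.range M, ∑ c : F n, t ⟨n, c⟩ (coeff (k - n) v) := by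
  rw [coeff_proSum (proSummable_of_isHomogeneous h),
    ← Finset.sum_sigma (Finset.range M) (fun n => (Finset.univ : Finset (F n)))
      (fun p => t p (coeff (k - p.1) v))]
  simp only [h _ k v]
  refine finsum_eq_sum_of_support_subset _ fun p hp => ?_
  by_contra hlt
  have : ¬ p.1 < M := by simpa using hlt
  exact hp (by simp only [hv (k - p.1) (by omega), map_zero])

/-- The expansion of a homogeneous family whose only member of degree zero is the identity. -/
theorem coeff_proSum_eq_add_sum [∀ n, Fintype (F n)] [Unique (F 0)]
    (h : ∀ p, IsHomogeneous p.1 (θ p) (t p)) (h0 : t ⟨0, default⟩ = 1) {N : ℤ}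
    {v : Completion 𝒱} (hv : v ∈ tail 𝒱 N) (k : ℤ) :
    coeff k (proSum θ v) =
      coeff k v + ∑ n ∈ Finset.Icc 1 (k - N).toNat, ∑ c : F n, t ⟨n, c⟩ (coeff (k - n) v) := by
  -- The extra `1` keeps `n = 0` in the range, also when `k < N` and `toNat` truncates to zero; that
  -- term is then split off as `v_k`.
  rw [coeff_proSum_of_isHomogeneous h (M := (k - N).toNat + 1) (by omega) hv, Finset.range_eq_Ico,
    Finset.sum_eq_sum_Ico_succ_bot (Nat.succ_pos _), Fintype.sum_unique, h0, Module.End.one_apply,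
    Nat.cast_zero, sub_zero]
  rfl

theorem isUnit_proSum_of_isHomogeneous [∀ n, Fintype (F n)] [Unique (F 0)]
    (h : ∀ p, IsHomogeneous p.1 (θ p) (t p)) (h0 : t ⟨0, default⟩ = 1) : IsUnit (proSum θ) :=
  isUnit_of_coeff_eq fun N v hv k hk => by
    -- For `k ≤ N` there is no room for a term of positive degree: the sum is empty.
    rw [coeff_proSum_eq_add_sum h h0 hv, Int.toNat_of_nonpos (by omega)]
    simp

theorem compositionTerm_zero {W : Type*} [AddCommGroup W] [Module ℂ W]
    (T : ℕ → Module.End ℂ W) (c : Composition 0) : Completion.compositionTerm T c = 1 := by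
  have : c.blocks = [] := List.length_eq_zero_iff.1 (Nat.le_zero.1 c.length_le)
  simp [Completion.compositionTerm, Composition.length, this]

theorem partitionTerm_zero {W : Type*} [AddCommGroup W] [Module ℂ W]
    (T : ℕ → Module.End ℂ W) (p : Nat.Partition 0) : Completion.partitionTerm T p = 1 := by
  simp [Completion.partitionTerm, Subsingleton.elim p default]

instance : Unique (Composition 0) where
  default := ⟨[], by simp, rfl⟩
  uniq c := Composition.ext (List.length_eq_zero_iff.1 (Nat.le_zero.1 c.length_le))

/-- The only partition of zero, as a partition with parts at least `n₀`. -/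
instance (n₀ : ℕ) : Unique (PartitionGE n₀ 0) where
  default := ⟨default, by simp⟩
  uniq _ := Subtype.ext (Subsingleton.elim _ _)

end Homogeneous

/-! ### Finite index sets for truncated expansions -/

section Lists

/-- The lists of length `p` with entries between `1` and `M`. -/
def boundedLists (M : ℕ) : ℕ → Finset (List ℕ)
  | 0 => {[]}
  | p + 1 => (Finset.Icc 1 M ×ˢ boundedLists M p).image fun q => q.1 :: q.2

theorem mem_boundedLists {M p : ℕ} {l : List ℕ} :
    l ∈ boundedLists M p ↔ l.length = p ∧ ∀ j ∈ l, 1 ≤ j ∧ j ≤ M := by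
  induction p generalizing l with
  | zero =>
    simp only [boundedLists, Finset.mem_singleton, List.length_eq_zero_iff]
    exact ⟨fun h => by simp [h], fun h => h.1⟩
  | succ p ih =>
    cases l with
    | nil => simp [boundedLists]
    | cons j l =>
      simp only [boundedLists, Finset.mem_image, Finset.mem_product, Finset.mem_Icc, ih,
        Prod.exists, List.cons.injEq, List.length_cons, List.mem_cons, forall_eq_or_imp]
      grind

theorem sum_boundedLists_succ {W : Type*} [AddCommMonoid W] (M p : ℕ) (g : List ℕ → W) :
    ∑ l ∈ boundedLists M (p + 1), g l =
      ∑ l ∈ boundedLists M p, ∑ j ∈ Finset.Icc 1 M, g (j :: l) := by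
  rw [boundedLists, Finset.sum_image (by grind [Set.InjOn]), Finset.sum_product_right]

/-- The operator `∏_{j ∈ s} T_j ^ n_j / n_j!`, where `n_j` is the multiplicity of `j` in `s` and
larger indices are to the left. -/
noncomputable def multisetTerm {W : Type*} [AddCommGroup W] [Module ℂ W] (T : ℕ → Module.End ℂ W)
    (s : Multiset ℕ) : Module.End ℂ W :=
  ((s.toFinset.sort (· ≥ ·)).map fun j => ((s.count j)! : ℂ)⁻¹ • T j ^ s.count j).prod

/-- An index above all others comes first in the decreasing order and leaves the other
multiplicities unchanged. This matches multiplying an ordered product on the left by its next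
factor. -/
theorem multisetTerm_add_replicate {W : Type*} [AddCommGroup W] [Module ℂ W]
    (T : ℕ → Module.End ℂ W) {s : Multiset ℕ} {j : ℕ} (hs : ∀ i ∈ s, i < j) (m : ℕ) :
    multisetTerm T (s + Multiset.replicate m j) = ((m ! : ℂ)⁻¹ • T j ^ m) * multisetTerm T s := by
  rcases Nat.eq_zero_or_pos m with rfl | hm
  · simp
  have hj : j ∉ s := fun h => (hs j h).false
  have h1 : (s + Multiset.replicate m j).toFinset = insert j s.toFinset := by
    ext i
    simp [hm.ne']
  rw [multisetTerm, h1, Finset.sort_insert _ (fun i hi => (hs i (by simpa using hi)).le)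
    (by simpa using hj), List.map_cons, List.prod_cons]
  congr 1
  · simp [Multiset.count_eq_zero_of_notMem hj]
  · refine congrArg List.prod (List.map_congr_left fun i hi => ?_)
    have hi' : i ∈ s := by simpa using hi
    have : i ≠ j := (hs i hi').ne
    simp [Multiset.count_replicate, this.symm]

/-- The multisets of numbers `j` with `n₀ ≤ j < n₀ + r`, of multiplicity at most `K` each. -/
def boundedMultisets (n₀ K : ℕ) : ℕ → Finset (Multiset ℕ)
  | 0 => {0}
  | r + 1 => (Finset.range (K + 1) ×ˢ boundedMultisets n₀ K r).image
      fun q => q.2 + Multiset.replicate q.1 (n₀ + r)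

theorem mem_boundedMultisets {n₀ K r : ℕ} {s : Multiset ℕ} :
    s ∈ boundedMultisets n₀ K r ↔ (∀ j ∈ s, n₀ ≤ j ∧ j < n₀ + r) ∧ ∀ j, s.count j ≤ K := by
  induction r generalizing s with
  | zero =>
    simp only [boundedMultisets, Finset.mem_singleton]
    refine ⟨by rintro rfl; simp, fun h => Multiset.eq_zero_of_forall_notMem fun j hj => ?_⟩
    have := h.1 j hj
    omega
  | succ r ih =>
    simp only [boundedMultisets, Finset.mem_image, Finset.mem_product, Finset.mem_range, ih,
      Prod.exists]
    constructor
    · rintro ⟨m, s, ⟨hm, hs, hc⟩, rfl⟩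
      refine ⟨fun j hj => ?_, fun j => ?_⟩
      · rcases Multiset.mem_add.1 hj with h | h
        · have := hs j h
          omega
        · have := Multiset.eq_of_mem_replicate h
          omega
      · rw [Multiset.count_add, Multiset.count_replicate]
        split_ifs with h
        · have : j ∉ s := fun hj => by have := hs j hj; omega
          rw [Multiset.count_eq_zero_of_notMem this]
          omega
        · simpa using hc j
    · rintro ⟨hs, hc⟩
      refine ⟨s.count (n₀ + r), s.filter (· ≠ n₀ + r), ⟨Nat.lt_succ_of_le (hc _), fun j hj => ?_,
        fun j => (Multiset.count_le_of_le _ (Multiset.filter_le _ _)).trans (hc j)⟩, ?_⟩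
      · have h1 := Multiset.mem_filter.1 hj
        have h2 := hs j h1.1
        have h3 := h1.2
        omega
      · rw [← Multiset.filter_eq', add_comm]
        exact Multiset.filter_add_not _ _

theorem sum_boundedMultisets_succ {W : Type*} [AddCommMonoid W] (n₀ K r : ℕ)
    (g : Multiset ℕ → W) :
    ∑ s ∈ boundedMultisets n₀ K (r + 1), g s =
      ∑ m ∈ Finset.range (K + 1), ∑ s ∈ boundedMultisets n₀ K r,
        g (s + Multiset.replicate m (n₀ + r)) := by
  rw [boundedMultisets, Finset.sum_image, Finset.sum_product]
  rintro ⟨m, s⟩ hs ⟨m', s'⟩ hs' h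
  -- The new index does not occur in `s`, so its count in the enlarged multiset recovers `m`; this
  -- gives injectivity.
  have key : ∀ s ∈ boundedMultisets n₀ K r, s.count (n₀ + r) = 0 := fun s hs =>
    Multiset.count_eq_zero_of_notMem fun hj => by
      have := (mem_boundedMultisets.1 hs).1 _ hj
      omega
  have hm : m = m' := by
    have := congrArg (Multiset.count (n₀ + r)) h
    simpa [key s (Finset.mem_product.1 hs).2, key s' (Finset.mem_product.1 hs').2] using this
  subst hm
  exact congrArg _ (add_right_cancel h)

end Lists

/-! ### Exponentials and ordered products on the completion -/

section Exponentials

variable {L V : Type*} [LieRing L] [LieAlgebra ℂ L] [AddCommGroup V] [Module ℂ V]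
  [LieRingModule L V] [LieModule ℂ L V]
  {𝒢 : ℤ → Submodule ℂ L} {𝒱 : ℤ → Submodule ℂ V} [GradedAction 𝒢 𝒢] [GradedAction 𝒢 𝒱]

theorem act_mem_tail {a b : ℤ} {x : Completion 𝒢} {v : Completion 𝒱} (hx : x ∈ tail 𝒢 a)
    (hv : v ∈ tail 𝒱 b) : act x v ∈ tail 𝒱 (a + b) := fun k hk => by
  rw [coeff_act]
  refine finsum_eq_zero_of_forall_eq_zero fun i => ?_
  rcases lt_or_ge i a with h | h
  · rw [hx i h, zero_lie]
  · rw [hv (k - i) (by omega), lie_zero]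

theorem raisesDegree_toEnd {x : Completion 𝒢} {d : ℕ} (hx : x ∈ tail 𝒢 d) :
    RaisesDegree d (LieModule.toEnd ℂ (Completion 𝒢) (Completion 𝒱) x) := fun k v hv => by
  rw [add_comm]
  exact act_mem_tail hx hv

theorem raisesDegree_expSeries {x : Completion 𝒢} (hx : x ∈ tail 𝒢 1) (p : ℕ) :
    RaisesDegree p (expSeries 𝒱 x p) := by
  have := (raisesDegree_toEnd (𝒱 := 𝒱) (d := 1) (by simpa using hx)).pow p
  rw [mul_one] at this
  exact this.smul _

variable (𝒱) in
theorem proSummable_expSeries {x : Completion 𝒢} (hx : x ∈ tail 𝒢 1) :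
    ProSummable (expSeries 𝒱 x) :=
  proSummable_of_raisesDegree (raisesDegree_expSeries hx)

theorem coeff_component (x : Completion 𝒢) (j : ℕ) (i : ℤ) :
    coeff i (component x j) = if i = j then coeff j x else 0 := by
  split_ifs with h
  · subst h
    exact congrArg Subtype.val (Pi.single_eq_same (M := fun m => 𝒢 m) (j : ℤ) (proj (j : ℤ) x))
  · exact congrArg Subtype.val
      (Pi.single_eq_of_ne (M := fun m => 𝒢 m) h (proj (j : ℤ) x))

theorem component_mem_tail (x : Completion 𝒢) {j : ℕ} (hj : 1 ≤ j) :
    component x j ∈ tail 𝒢 1 := fun m hm => by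
  rw [coeff_component, if_neg (by omega)]

variable (𝒱) in
theorem isHomogeneous_rhoHat (x : Completion 𝒢) (j : ℕ) :
    IsHomogeneous j (rhoHat 𝒱 x j) (LieModule.toEnd ℂ L V (coeff (j : ℤ) x)) := fun k v => by
  change coeff k (act (component x j) v) = ⁅coeff (j : ℤ) x, coeff (k - j) v⁆
  rw [coeff_act, finsum_eq_single _ (j : ℤ)]
  · rw [coeff_component, if_pos rfl]
  · intro i hi
    rw [coeff_component, if_neg hi, zero_lie]

/-- The cut-off `K` may exceed `k - N`, so that one value serves every lower degree met when the
operator is iterated. -/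
theorem coeff_toEnd_apply {x : Completion 𝒢} (hx : x ∈ tail 𝒢 1) {N k : ℤ} {K : ℕ}
    (hK : k ≤ N + K) {v : Completion 𝒱} (hv : v ∈ tail 𝒱 N) :
    coeff k (LieModule.toEnd ℂ (Completion 𝒢) (Completion 𝒱) x v) =
      ∑ j ∈ Finset.Icc 1 K, LieModule.toEnd ℂ L V (coeff (j : ℤ) x) (coeff (k - j) v) := by
  change coeff k (act x v) = _
  rw [coeff_act, finsum_eq_sum_of_support_subset (s := (Finset.Icc 1 K).map Nat.castEmbedding),
    Finset.sum_map]
  · rfl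
  · intro i hi
    by_contra hn
    refine hi ?_
    rcases lt_or_ge i 1 with h | h
    · simp [hx i h]
    · have : K < i := by
        by_contra hle
        exact hn (by simpa using ⟨i.toNat, by omega, by omega⟩)
      simp [hv (k - i) (by omega)]

theorem coeff_toEnd_pow_apply {x : Completion 𝒢} (hx : x ∈ tail 𝒢 1) {N k : ℤ} {K : ℕ}
    (hK : k ≤ N + K) (p : ℕ) {v : Completion 𝒱} (hv : v ∈ tail 𝒱 N) :
    coeff k ((LieModule.toEnd ℂ (Completion 𝒢) (Completion 𝒱) x ^ p) v) =
      ∑ l ∈ boundedLists K p,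
        (l.map fun j : ℕ => LieModule.toEnd ℂ L V (coeff (j : ℤ) x)).reverse.prod
          (coeff (k - (l.sum : ℕ)) v) := by
  induction p generalizing v with
  | zero => simp [boundedLists]
  | succ p ih =>
    have hv' : LieModule.toEnd ℂ (Completion 𝒢) (Completion 𝒱) x v ∈ tail 𝒱 N :=
      tail_anti (by omega) (act_mem_tail hx hv)
    rw [pow_succ, Module.End.mul_apply, ih hv', sum_boundedLists_succ]
    refine Finset.sum_congr rfl fun l _ => ?_
    rw [coeff_toEnd_apply hx (K := K) (by omega) hv, map_sum]
    refine Finset.sum_congr rfl fun j _ => ?_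
    simp only [List.map_cons, List.reverse_cons, List.prod_append, List.prod_singleton,
      Module.End.mul_apply, List.sum_cons, Nat.cast_add, add_comm (j : ℤ), sub_sub]

variable (𝒱) in
theorem isHomogeneous_expExpansion (x : Completion 𝒢) (c : Σ n : ℕ, Composition n) :
    IsHomogeneous c.1 (expExpansion 𝒱 x c)
      (compositionTerm (fun j => LieModule.toEnd ℂ L V (coeff (j : ℤ) x)) c.2) :=
  IsHomogeneous.compositionTerm (isHomogeneous_rhoHat 𝒱 x) c.2

variable (𝒱) in
-- In degree `k` both sides are finite sums over lists. A composition of `n ≤ K` has at most `K`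
-- blocks, each at most `K`, so it occurs among the lists from the powers. The other lists have sum
-- above `K` and act on components of `v` below degree `N`.
theorem proSum_expExpansion {x : Completion 𝒢} (hx : x ∈ tail 𝒢 1) :
    proSum (expExpansion 𝒱 x) = expRho 𝒱 x := by
  refine LinearMap.ext fun v => ext fun k => ?_
  obtain ⟨N, hv⟩ := exists_mem_tail v
  set K := (k - N).toNat with hK
  rw [coeff_proSum_of_isHomogeneous (isHomogeneous_expExpansion 𝒱 x) (M := K + 1) (by omega) hv,
    expRho, coeff_proSum_of_raisesDegree (raisesDegree_expSeries hx) (M := K + 1) (by omega) hv]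
  simp only [expSeries, LinearMap.smul_apply, map_smul,
    coeff_toEnd_pow_apply hx (K := K) (by omega : k ≤ N + K) _ hv, Finset.smul_sum]
  rw [← Finset.sum_sigma (Finset.range (K + 1)) (fun n => (Finset.univ : Finset (Composition n)))
      (fun c => compositionTerm (fun j => LieModule.toEnd ℂ L V (coeff (j : ℤ) x)) c.2
        (coeff (k - c.1) v)),
    ← Finset.sum_sigma (Finset.range (K + 1)) (boundedLists K) (fun q => (q.1 ! : ℂ)⁻¹ •
      (q.2.map fun j : ℕ => LieModule.toEnd ℂ L V (coeff (j : ℤ) x)).reverse.prod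
          (coeff (k - (q.2.sum : ℕ)) v))]
  -- The length of a composition is the exponent of the power of `ρ(x)` that produces its monomial.
  refine Finset.sum_of_injOn (fun c => ⟨c.2.length, c.2.blocks⟩) ?_ ?_ ?_ ?_
  · rintro ⟨n, c⟩ - ⟨n', c'⟩ - h
    have hb : c.blocks = c'.blocks := by
      simp only [Sigma.mk.injEq] at h
      exact eq_of_heq h.2
    obtain rfl : n = n' := by rw [← c.blocks_sum, hb, c'.blocks_sum]
    rw [Composition.ext hb]
  · rintro ⟨n, c⟩ hc
    have hn : n < K + 1 := by simpa using hc
    have := c.length_le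
    simp only [Finset.coe_sigma, Set.mem_sigma_iff, Finset.coe_range, Set.mem_Iio, Finset.mem_coe,
      mem_boundedLists]
    refine ⟨by omega, trivial, fun j hj => ⟨c.blocks_pos hj, ?_⟩⟩
    have := List.le_sum_of_mem hj
    rw [c.blocks_sum] at this
    omega
  · rintro ⟨p, l⟩ hl hne
    simp only [Finset.mem_sigma, mem_boundedLists] at hl
    have hsum : K < l.sum := by
      by_contra hle
      refine hne ⟨⟨l.sum, ⟨l, fun hj => (hl.2.2 _ hj).1, rfl⟩⟩, ?_, ?_⟩
      · simpa using by omega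
      · simp [Composition.length, hl.2.1]
    rw [hv _ (by dsimp only; omega), map_zero, smul_zero]
  · rintro ⟨n, c⟩ -
    simp only [compositionTerm, LinearMap.smul_apply, c.blocks_sum]

theorem coeff_expRho_component (x : Completion 𝒢) {j : ℕ} (hj : 1 ≤ j) {N k : ℤ} {K : ℕ}
    (hK : k ≤ N + K) {v : Completion 𝒱} (hv : v ∈ tail 𝒱 N) :
    coeff k (expRho 𝒱 (component x j) v) = ∑ m ∈ Finset.range (K + 1),
      ((m ! : ℂ)⁻¹ • LieModule.toEnd ℂ L V (coeff (j : ℤ) x) ^ m) (coeff (k - (m * j : ℕ)) v) := by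
  rw [expRho, coeff_proSum_of_raisesDegree (raisesDegree_expSeries (component_mem_tail x hj))
    (M := K + 1) (by omega) hv]
  exact Finset.sum_congr rfl fun m _ => ((isHomogeneous_rhoHat 𝒱 x j).pow m).smul _ k v

/-- Each further exponential contributes the multiplicity `m` of a new largest index. The induction
varies `k`, since that factor reads the previous product in degree `k - m (n₀ + r)`. -/
theorem coeff_partialProd (x : Completion 𝒢) {n₀ : ℕ} (hn₀ : 1 ≤ n₀) {N k : ℤ} {K : ℕ}
    (hK : k ≤ N + K) (r : ℕ) {v : Completion 𝒱} (hv : v ∈ tail 𝒱 N) :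
    coeff k (partialProd 𝒱 x n₀ r v) = ∑ s ∈ boundedMultisets n₀ K r,
      multisetTerm (fun j => LieModule.toEnd ℂ L V (coeff (j : ℤ) x)) s
        (coeff (k - (s.sum : ℕ)) v) := by
  induction r generalizing k with
  | zero => simp [boundedMultisets, partialProd, multisetTerm]
  | succ r ih =>
    have htail : partialProd 𝒱 x n₀ r v ∈ tail 𝒱 N := fun k hk => by
      rw [ih (by omega)]
      exact Finset.sum_eq_zero fun s _ => by rw [hv _ (by omega), map_zero]
    rw [partialProd, Module.End.mul_apply, coeff_expRho_component x (by omega) hK htail,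
      sum_boundedMultisets_succ]
    refine Finset.sum_congr rfl fun m _ => ?_
    rw [ih (by omega), map_sum]
    refine Finset.sum_congr rfl fun s hs => ?_
    rw [multisetTerm_add_replicate _ fun i hi => ((mem_boundedMultisets.1 hs).1 i hi).2,
      Module.End.mul_apply, Multiset.sum_add, Multiset.sum_replicate, smul_eq_mul, sub_sub,
      ← Nat.cast_add, add_comm s.sum]

variable (𝒱) in
theorem isHomogeneous_prodExpansion (x : Completion 𝒢) (n₀ : ℕ) (p : Σ n : ℕ, PartitionGE n₀ n) :
    IsHomogeneous p.1 (prodExpansion 𝒱 x n₀ p)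
      (partitionTerm (fun j => LieModule.toEnd ℂ L V (coeff (j : ℤ) x)) p.2.1) :=
  IsHomogeneous.partitionTerm (isHomogeneous_rhoHat 𝒱 x) p.2.1

/-- The factors left out have index at least `n₀ + r > k - N`, too large to affect degree `k`. Parts
and multiplicities of a partition of `n` are at most `n`, so the bounded multisets contain all
relevant partitions; those of sum above `K` contribute zero. -/
theorem coeff_partialProd_eq (x : Completion 𝒢) {n₀ : ℕ} (hn₀ : 1 ≤ n₀) {N k : ℤ} {r : ℕ}
    (hr : k < N + r) {v : Completion 𝒱} (hv : v ∈ tail 𝒱 N) :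
    coeff k (partialProd 𝒱 x n₀ r v) = coeff k (proSum (prodExpansion 𝒱 x n₀) v) := by
  set K := (k - N).toNat with hK
  rw [coeff_proSum_of_isHomogeneous (isHomogeneous_prodExpansion 𝒱 x n₀) (M := K + 1) (by omega) hv,
    coeff_partialProd x hn₀ (K := K) (by omega) r hv,
    ← Finset.sum_sigma (Finset.range (K + 1))
      (fun n => (Finset.univ : Finset (PartitionGE n₀ n)))
      (fun p => partitionTerm (fun j => LieModule.toEnd ℂ L V (coeff (j : ℤ) x)) p.2.1
        (coeff (k - p.1) v))]
  symm
  rcases lt_or_ge k N with hkN | hkN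
  · rw [Finset.sum_eq_zero fun p _ => by rw [hv _ (by omega), map_zero],
      Finset.sum_eq_zero fun p _ => by rw [hv _ (by omega), map_zero]]
  refine Finset.sum_of_injOn (fun p => p.2.1.parts) ?_ ?_ ?_ ?_
  · rintro ⟨n, p, hp⟩ - ⟨n', p', hp'⟩ - (h : p.parts = p'.parts)
    obtain rfl : n = n' := by rw [← p.parts_sum, h, p'.parts_sum]
    obtain rfl : p = p' := Nat.Partition.ext h
    rfl
  · rintro ⟨n, p, hp⟩ hn
    have hn : n < K + 1 := by simpa using hn
    have hle : ∀ j ∈ p.parts, j ≤ n := fun j hj => by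
      have := Multiset.le_sum_of_mem hj
      rwa [p.parts_sum] at this
    have hcount : ∀ j, p.parts.count j ≤ n := fun j => by
      refine (Multiset.count_le_card _ _).trans ?_
      have := Multiset.card_nsmul_le_sum (s := p.parts) (a := 1) fun j hj => p.parts_pos hj
      rwa [p.parts_sum, smul_eq_mul, mul_one] at this
    refine Finset.mem_coe.2 (mem_boundedMultisets.2 ⟨fun j hj => ⟨hp j hj, ?_⟩, fun j => ?_⟩)
    · have := hle j hj
      omega
    · exact (hcount j).trans (Nat.le_of_lt_succ hn)
  · intro s hs hne
    have hs := (mem_boundedMultisets.1 hs).1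
    have hsum : K < s.sum := by
      by_contra hle
      refine hne ⟨⟨s.sum, ⟨s, fun hj => hn₀.trans (hs _ hj).1, rfl⟩, fun j hj => (hs j hj).1⟩,
        ?_, rfl⟩
      simpa using by omega
    rw [hv _ (by omega), map_zero]
  · rintro ⟨n, p, hp⟩ -
    simp only [p.parts_sum]
    rfl

/-- Each coefficient of the partial products is constant from some `r` on, so existence, uniqueness
and the value of the limit come together. -/
theorem isOrderedProd_iff (x : Completion 𝒢) {n₀ : ℕ} (hn₀ : 1 ≤ n₀)
    (S : Module.End ℂ (Completion 𝒱)) :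
    IsOrderedProd 𝒱 x n₀ S ↔ S = proSum (prodExpansion 𝒱 x n₀) := by
  rw [LinearMap.ext_iff]
  refine forall_congr' fun v => tendsto_iff_of_eventually_coeff_eq (fun k => ?_) (S v)
  obtain ⟨N, hv⟩ := exists_mem_tail v
  refine (Filter.eventually_gt_atTop (k - N).toNat).mono fun r hr => ?_
  exact coeff_partialProd_eq x hn₀ (by omega) hv

variable (𝒱) in
theorem isUnit_expRho {x : Completion 𝒢} (hx : x ∈ tail 𝒢 1) : IsUnit (expRho 𝒱 x) := by
  rw [← proSum_expExpansion 𝒱 hx]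
  exact isUnit_proSum_of_isHomogeneous (isHomogeneous_expExpansion 𝒱 x) (compositionTerm_zero _ _)

variable (𝒱) in
theorem isUnit_proSum_prodExpansion (x : Completion 𝒢) (n₀ : ℕ) :
    IsUnit (proSum (prodExpansion 𝒱 x n₀)) :=
  isUnit_proSum_of_isHomogeneous (isHomogeneous_prodExpansion 𝒱 x n₀) (partitionTerm_zero _ _)

end Exponentials

/-! ### Compatibility with the Lie bracket -/

section Automorphisms

variable {L : Type*} [LieRing L] [LieAlgebra ℂ L] {𝒢 : ℤ → Submodule ℂ L} [GradedAction 𝒢 𝒢]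

theorem lie_mem_tail {a b : ℤ} {x y : Completion 𝒢} (hx : x ∈ tail 𝒢 a) (hy : y ∈ tail 𝒢 b) :
    ⁅x, y⁆ ∈ tail 𝒢 (a + b) :=
  act_mem_tail hx hy

/-- This is the iterated Leibniz rule for the derivation `ad x`; dividing by `p!` turns the binomial
coefficients into `1 / (q₁! q₂!)`. -/
theorem expSeries_lie (x y z : Completion 𝒢) (p : ℕ) :
    expSeries 𝒢 x p ⁅y, z⁆ =
      ∑ q ∈ Finset.HasAntidiagonal.antidiagonal p, ⁅expSeries 𝒢 x q.1 y, expSeries 𝒢 x q.2 z⁆ := by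
  have h : ∀ (n : ℕ) (w : Completion 𝒢),
      (LieModule.toEnd ℂ (Completion 𝒢) (Completion 𝒢) x ^ n) w =
        (LieDerivation.ad ℂ (Completion 𝒢) x)^[n] w := fun n w => by
    rw [Module.End.pow_apply]
    congr 2
    exact LinearMap.ext fun w => (LieDerivation.ad_apply_apply ℂ (Completion 𝒢) x w).symm
  simp only [expSeries, LinearMap.smul_apply, h, LieDerivation.iterate_apply_lie, Finset.smul_sum]
  refine Finset.sum_congr rfl fun q hq => ?_
  rw [smul_lie, lie_smul, smul_smul, ← Nat.cast_smul_eq_nsmul ℂ, smul_smul]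
  congr 1
  rw [← Finset.HasAntidiagonal.mem_antidiagonal.1 hq, Nat.choose_symm_add, Nat.add_choose,
    Nat.cast_div (Nat.factorial_mul_factorial_dvd_factorial_add _ _)]
  · have := Nat.cast_ne_zero (R := ℂ).2 (q.1 + q.2).factorial_ne_zero
    push_cast
    field_simp
  · exact_mod_cast mul_ne_zero (Nat.factorial_ne_zero _) (Nat.factorial_ne_zero _)

/-- An operator that is approximated, to arbitrary order, by operators preserving brackets up to
higher order preserves brackets. -/
theorem map_lie_of_approx {T : Module.End ℂ (Completion 𝒢)}
    {U : ℕ → Module.End ℂ (Completion 𝒢)}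
    (hU : ∀ (m : ℕ) (N : ℤ), ∀ v ∈ tail 𝒢 N, U m v ∈ tail 𝒢 N)
    (h : ∀ (m : ℕ) (N : ℤ), ∀ v ∈ tail 𝒢 N, T v - U m v ∈ tail 𝒢 (N + m))
    (hlie : ∀ (m : ℕ) (a b : ℤ), ∀ y ∈ tail 𝒢 a, ∀ z ∈ tail 𝒢 b,
      U m ⁅y, z⁆ - ⁅U m y, U m z⁆ ∈ tail 𝒢 (a + b + m)) (y z : Completion 𝒢) :
    T ⁅y, z⁆ = ⁅T y, T z⁆ := by
  obtain ⟨a, hy⟩ := exists_mem_tail y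
  obtain ⟨b, hz⟩ := exists_mem_tail z
  refine eq_of_sub_mem_tail (a + b) fun m => ?_
  have hTz : T z ∈ tail 𝒢 b := by
    have := (tail 𝒢 b).add_mem (tail_anti (by omega) (h m b z hz)) (hU m b z hz)
    rwa [sub_add_cancel] at this
  have h1 := h m _ _ (lie_mem_tail hy hz)
  have h2 := hlie m a b y hy z hz
  have h3 : ⁅T y - U m y, T z⁆ ∈ tail 𝒢 (a + b + m) :=
    tail_anti (by omega) (lie_mem_tail (h m a y hy) hTz)
  have h4 : ⁅U m y, T z - U m z⁆ ∈ tail 𝒢 (a + b + m) :=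
    tail_anti (by omega) (lie_mem_tail (hU m a y hy) (h m b z hz))
  -- With `U = U m`, `T⁅y,z⁆ - ⁅Ty,Tz⁆` equals `(T - U)⁅y,z⁆ + (U⁅y,z⁆ - ⁅Uy,Uz⁆) - ⁅Ty - Uy, Tz⁆ -
  -- ⁅Uy, Tz - Uz⁆`.
  have h5 := (tail 𝒢 _).sub_mem ((tail 𝒢 _).sub_mem ((tail 𝒢 _).add_mem h1 h2) h3) h4
  rw [sub_lie, lie_sub] at h5
  convert h5 using 1
  abel

/-- For the exponential truncated at `m`, applying it to `⁅y, z⁆` gives the triangle `q₁ + q₂ < m`,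
while bracketing the two images gives the square `q₁, q₂ < m`. The difference consists of terms with
`q₁ + q₂ ≥ m`, which lie in `tail 𝒢 (a + b + m)`. -/
theorem expRho_lie {x : Completion 𝒢} (hx : x ∈ tail 𝒢 1) (y z : Completion 𝒢) :
    expRho 𝒢 x ⁅y, z⁆ = ⁅expRho 𝒢 x y, expRho 𝒢 x z⁆ := by
  have hp := raisesDegree_expSeries (𝒱 := 𝒢) hx
  refine map_lie_of_approx (U := fun m => ∑ p ∈ Finset.range m, expSeries 𝒢 x p)
    (fun m N v hv => ?_) (fun m N v hv => ?_) (fun m a b y hy z hz => ?_) y z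
  · rw [LinearMap.sum_apply]
    exact (tail 𝒢 N).sum_mem fun p _ => tail_anti (by omega) (hp p N v hv)
  · rw [LinearMap.sum_apply]
    exact proSum_sub_mem_tail hp m hv
  · simp only [LinearMap.sum_apply, expSeries_lie, sum_lie_sum]
    have hfib : ∀ p < m, {q ∈ (Finset.range m ×ˢ Finset.range m).filter
        (fun q => q.1 + q.2 < m) | q.1 + q.2 = p} = Finset.HasAntidiagonal.antidiagonal p := by
      intro p hpm
      ext q
      simp only [Finset.mem_filter, Finset.mem_product, Finset.mem_range,
        Finset.HasAntidiagonal.mem_antidiagonal]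
      omega
    have h1 : ∑ p ∈ Finset.range m, ∑ q ∈ Finset.HasAntidiagonal.antidiagonal p,
          ⁅expSeries 𝒢 x q.1 y, expSeries 𝒢 x q.2 z⁆ =
        ∑ q ∈ (Finset.range m ×ˢ Finset.range m).filter (fun q => q.1 + q.2 < m),
          ⁅expSeries 𝒢 x q.1 y, expSeries 𝒢 x q.2 z⁆ := by
      rw [← Finset.sum_fiberwise_of_maps_to (g := fun q : ℕ × ℕ => q.1 + q.2) (t := Finset.range m)
        (by simp)]
      exact Finset.sum_congr rfl fun p hpm => by rw [hfib p (Finset.mem_range.1 hpm)]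
    rw [h1, ← Finset.sum_product', ← Finset.sum_filter_add_sum_filter_not
      (Finset.range m ×ˢ Finset.range m) (fun q => q.1 + q.2 < m), sub_add_cancel_left]
    refine neg_mem (sum_mem fun q hq => ?_)
    have := (Finset.mem_filter.1 hq).2
    exact tail_anti (by omega) (lie_mem_tail (hp q.1 a y hy) (hp q.2 b z hz))

theorem partialProd_lie (x : Completion 𝒢) {n₀ : ℕ} (hn₀ : 1 ≤ n₀) (r : ℕ)
    (y z : Completion 𝒢) :
    partialProd 𝒢 x n₀ r ⁅y, z⁆ = ⁅partialProd 𝒢 x n₀ r y, partialProd 𝒢 x n₀ r z⁆ := by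
  induction r with
  | zero => rfl
  | succ r ih =>
    simp only [partialProd, Module.End.mul_apply, ih]
    exact expRho_lie (component_mem_tail x (by omega)) _ _

/-- The approximating operators are the partial products, which preserve brackets exactly. -/
theorem proSum_prodExpansion_lie (x : Completion 𝒢) {n₀ : ℕ} (hn₀ : 1 ≤ n₀)
    (y z : Completion 𝒢) :
    proSum (prodExpansion 𝒢 x n₀) ⁅y, z⁆ =
      ⁅proSum (prodExpansion 𝒢 x n₀) y, proSum (prodExpansion 𝒢 x n₀) z⁆ := by
  have hT : ∀ N : ℤ, ∀ v ∈ tail 𝒢 N, proSum (prodExpansion 𝒢 x n₀) v ∈ tail 𝒢 N :=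
    fun N v hv k hk => by
      rw [coeff_proSum_of_isHomogeneous (isHomogeneous_prodExpansion 𝒢 x n₀) (M := 0)
        (by simpa using hk) hv, Finset.sum_range_zero]
  have h : ∀ (m : ℕ) (N : ℤ), ∀ v ∈ tail 𝒢 N,
      proSum (prodExpansion 𝒢 x n₀) v - partialProd 𝒢 x n₀ m v ∈ tail 𝒢 (N + m) :=
    fun m N v hv k hk => by rw [map_sub, coeff_partialProd_eq x hn₀ hk hv, sub_self]
  refine map_lie_of_approx (fun m N v hv => ?_) h (fun m a b y _ z _ => ?_) y z
  · have := (tail 𝒢 N).sub_mem (hT N v hv) (tail_anti (by omega) (h m N v hv))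
    rwa [sub_sub_cancel] at this
  · rw [partialProd_lie x hn₀, sub_self]
    exact zero_mem _

/-- An invertible operator preserving brackets, as an automorphism. -/
theorem exists_lieEquiv {T : Module.End ℂ (Completion 𝒢)} (hT : IsUnit T)
    (h : ∀ y z : Completion 𝒢, T ⁅y, z⁆ = ⁅T y, T z⁆) :
    ∃ E : Completion 𝒢 ≃ₗ⁅ℂ⁆ Completion 𝒢, E.toLinearEquiv.toLinearMap = T :=
  ⟨LieEquiv.ofBijective { T with map_lie' := h _ _ } ((Module.End.isUnit_iff T).1 hT), rfl⟩

end Automorphisms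

end Completion

/-! ### The theorem for Kac–Moody algebras -/

theorem mainTheorem5 {ℓ : ℕ} (A : Matrix (Fin ℓ) (Fin ℓ) ℤ) (hA : KacMoody.IsGCM A)
    (hsymm : KacMoody.IsSymmetrizable A) {𝔥 : Type*} [AddCommGroup 𝔥] [Module ℂ 𝔥]
    (R : KacMoody.Realization A 𝔥) (P : AddSubgroup (Module.Dual ℂ 𝔥))
    (hP : KacMoody.IsRestrictedWeightLattice R P) :
    -- an arbitrary standard graded module `V`
    (∀ (V : Type*) [AddCommGroup V] [Module ℂ V] [LieRingModule (KacMoody.KMAlgebra R) V]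
      [LieModule ℂ (KacMoody.KMAlgebra R) V] (f : P →+ ℤ), KacMoody.IsStandardGraded R f V →
      ∀ x ∈ KacMoody.nHat R f,
        -- `exp (ρ(x))`
        (Completion.ProSummable (Completion.expSeries (KacMoody.gradedPiece R f V) x) ∧
          Completion.ProSummable (Completion.expExpansion (KacMoody.gradedPiece R f V) x) ∧
          Completion.proSum (Completion.expExpansion (KacMoody.gradedPiece R f V) x) =
            Completion.expRho (KacMoody.gradedPiece R f V) x ∧
          (∀ (v : KacMoody.ModuleHat R f V) (N : ℤ), (∀ i < N, Completion.coeff i v = 0) →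
            ∀ k : ℤ, Completion.coeff k (Completion.expRho (KacMoody.gradedPiece R f V) x v) =
              Completion.coeff k v + ∑ n ∈ Finset.Icc 1 (k - N).toNat, ∑ c : Composition n,
                Completion.compositionTerm
                  (fun j => LieModule.toEnd ℂ (KacMoody.KMAlgebra R) V (Completion.coeff (j : ℤ) x)) c
                  (Completion.coeff (k - n) v)) ∧
          IsUnit (Completion.expRho (KacMoody.gradedPiece R f V) x)) ∧
        -- the ordered product `∏_{j ≥ n₀} exp (ρ(x_j))`
        ∀ n₀ : ℕ, 1 ≤ n₀ → ∃ T : Module.End ℂ (KacMoody.ModuleHat R f V),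
          (∀ S : Module.End ℂ (KacMoody.ModuleHat R f V),
            Completion.IsOrderedProd (KacMoody.gradedPiece R f V) x n₀ S ↔ S = T) ∧
          Completion.ProSummable (Completion.prodExpansion (KacMoody.gradedPiece R f V) x n₀) ∧
          Completion.proSum (Completion.prodExpansion (KacMoody.gradedPiece R f V) x n₀) = T ∧
          (∀ (v : KacMoody.ModuleHat R f V) (N : ℤ), (∀ i < N, Completion.coeff i v = 0) →
            ∀ k : ℤ, Completion.coeff k (T v) =
              Completion.coeff k v + ∑ n ∈ Finset.Icc 1 (k - N).toNat,
                ∑ p : Completion.PartitionGE n₀ n, Completion.partitionTerm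
                  (fun j => LieModule.toEnd ℂ (KacMoody.KMAlgebra R) V (Completion.coeff (j : ℤ) x)) p.1
                  (Completion.coeff (k - n) v)) ∧
          IsUnit T) ∧
    -- the adjoint module
    (∀ f : P →+ ℤ, KacMoody.IsStandardGraded R f (KacMoody.KMAlgebra R) →
      ∀ x ∈ KacMoody.nHat R f,
        (∃ E : KacMoody.AlgebraHat R f ≃ₗ⁅ℂ⁆ KacMoody.AlgebraHat R f,
          E.toLinearEquiv.toLinearMap =
            Completion.expRho (KacMoody.gradedPiece R f (KacMoody.KMAlgebra R)) x) ∧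
        ∀ n₀ : ℕ, 1 ≤ n₀ → ∃ E : KacMoody.AlgebraHat R f ≃ₗ⁅ℂ⁆ KacMoody.AlgebraHat R f,
          Completion.IsOrderedProd (KacMoody.gradedPiece R f (KacMoody.KMAlgebra R)) x n₀
            E.toLinearEquiv.toLinearMap) := by
  refine ⟨fun V _ _ _ _ f _ x hx => ⟨⟨Completion.proSummable_expSeries _ hx,
      Completion.proSummable_of_isHomogeneous (Completion.isHomogeneous_expExpansion _ x),
      Completion.proSum_expExpansion _ hx, ?_, ?_⟩, fun n₀ hn₀ =>
      ⟨Completion.proSum (Completion.prodExpansion _ x n₀),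
        Completion.isOrderedProd_iff x hn₀,
        Completion.proSummable_of_isHomogeneous (Completion.isHomogeneous_prodExpansion _ x n₀),
        rfl, ?_, ?_⟩⟩, fun f _ x hx => ⟨?_, fun n₀ hn₀ => ?_⟩⟩
  · rw [← Completion.proSum_expExpansion _ hx]
    -- Vanishing below `N` is, by definition, membership in the tail at `N`.
    exact fun v N hv k => Completion.coeff_proSum_eq_add_sum
      (Completion.isHomogeneous_expExpansion _ x) (Completion.compositionTerm_zero _ _) hv k
  · exact Completion.isUnit_expRho _ hx
  · exact fun v N hv k => Completion.coeff_proSum_eq_add_sum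
      (Completion.isHomogeneous_prodExpansion _ x n₀) (Completion.partitionTerm_zero _ _) hv k
  · exact Completion.isUnit_proSum_prodExpansion _ x n₀
  · exact Completion.exists_lieEquiv (Completion.isUnit_expRho _ hx) (Completion.expRho_lie hx)
  · obtain ⟨E, hE⟩ := Completion.exists_lieEquiv (Completion.isUnit_proSum_prodExpansion _ x n₀)
      (Completion.proSum_prodExpansion_lie x hn₀)
    exact ⟨E, (Completion.isOrderedProd_iff x hn₀ _).2 hE⟩
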